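/- Let $2\le m<n$, let $P$ be a probability mass function on $\{1,\dots,n\}$, and let $p_1\ge p_2\ge\dots\ge p_n$ be its masses in decreasing order. All entropies $H_\alpha$ are Rényi entropies, $H_\alpha(Q)=\frac1{1-\alpha}\log\sum_x Q(x)^\alpha$ for $\alpha\in(0,1)$, and $\log$ is taken to an arbitrary fixed base $b>1$. Let $\widetilde X_m$ be a random variable on $\{1,\dots,m\}$ that is equiprobable if $p_1<\frac1m$, and otherwise has masses $P_{\widetilde X_m}(i)=p_i$ for $i\le n^\ast$ and $P_{\widetilde X_m}(i)=\frac1{m-n^\ast}\sum_{j=n^\ast+1}^n p_j$ for $n^\ast<i\le m$, where $n^\ast$ is the largest $i\in\{1,\dots,m-1\}$ with $p_i\ge\frac1{m-i}\sum_{j=i+1}^n p_j$. For $\alpha>0$, $\alpha\ne1$, let $$v(\alpha)=\log\Bigl(\frac{\alpha-1}{2^\alpha-2}\Bigr)-\frac{\alpha}{\alpha-1}\log\Bigl(\frac{\alpha}{2^\alpha-1}\Bigr).$$ A Huffman function $f^\ast:\{1,\dots,n\}\to\{1,\dots,m\}$ is one obtained as follows: start from the $n$ singletons, repeatedly merge two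 blocks of smallest probability (ties broken arbitrarily) until exactly $m$ blocks remain, number these $1,\dots,m$ in decreasing order of probability, and let $f^\ast(x)$ be the number of the block that contains $x$. For $k\ge1$ let $X_1,\dots,X_k$ be i.i.d. with $X_1\sim P$, $X^k=(X_1,\dots,X_k)$, and for $f:\{1,\dots,n\}\to\{1,\dots,m\}$ let $Y_i=f(X_i)$, $Y^k=(Y_1,\dots,Y_k)$. Let $g_{X^k}$ and $g_{Y^k}$ be ranking functions of $X^k$ and $Y^k$, i.e. bijections from $\{1,\dots,n\}^k$ onto $\{1,\dots,n^k\}$ and from $\{1,\dots,m\}^k$ onto $\{1,\dots,m^k\}$ that list the vectors in decreasing order of probability (ties broken arbitrarily). Then for every $\rho>0$, with $X\sim P$: (a) for every $f:\{1,\dots,n\}\to\{1,\dots,m\}$ and every $k\ge1$, $$\frac1k\log\frac{\mathbb E[g_{X^k}^\rho(X^k)]}{\mathbb E[g_{Y^k}^\rho(Y^k)]}\ \ge\ \rho\bigl[H_{\frac1{1+\rho}}(X)-H_{\frac1{1+\rho}}(\widetilde X_m)\bigr]-\frac{\rho\log(1+k\ln n)}k ;$$ (b) a Huffman function exists, and for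 every Huffman function $f=f^\ast$ (which does not depend on $\rho$ or $k$) and every $k\ge1$, $$\frac1k\log\frac{\mathbb E[g_{X^k}^\rho(X^k)]}{\mathbb E[g_{Y^k}^\rho(Y^k)]}\ \le\ \rho\Bigl[H_{\frac1{1+\rho}}(X)-H_{\frac1{1+\rho}}(\widetilde X_m)+v\bigl(\tfrac1{1+\rho}\bigr)\Bigr]+\frac{\rho\log(1+k\ln m)}k ;$$ (c) as $k\to\infty$, the difference between the upper bound in (b) and the lower bound in (a) converges to $\rho\,v\bigl(\tfrac1{1+\rho}\bigr)$; for logarithms to the base $2$, this limit equals $\frac{0.08607\,\rho}{1+\rho}$ up to a relative error of at most $1\%$. -/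

import Mathlib

open MeasureTheory ProbabilityTheory Filter Topology

noncomputable section

namespace Guessing

/-- Rényi entropy of order `α > 0`, with logarithms to the base `b`, of a probability mass
function on a finite set (the Shannon entropy if `α = 1`). -/
def renyiEntropy {A : Type*} [Fintype A] (b α : ℝ) (p : A → ℝ) : ℝ :=
  if α = 1 then ∑ x, p x * Real.logb b (1 / p x)
  else 1 / (1 - α) * Real.logb b (∑ x, p x ^ α)

/-- The function `v`, with logarithms to the base `b`. -/
def v (b α : ℝ) : ℝ :=
  if α = 1 then Real.logb b (2 / (Real.exp 1 * Real.log 2))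
  else Real.logb b ((α - 1) / (2 ^ α - 2)) - α / (α - 1) * Real.logb b (α / (2 ^ α - 1))

/-- The masses of `p` in decreasing order: `rankedMass p i` is the `(i + 1)`-th largest mass
(`0` for `i ≥ n`). -/
def rankedMass {n : ℕ} (p : Fin n → ℝ) (i : ℕ) : ℝ :=
  if h : i < n then p (Tuple.sort (fun a => - p a) ⟨i, h⟩) else 0

/-- `n*`: the largest `i ∈ {1, …, m - 1}` such that the `i`-th largest mass of `p` is at least
`1 / (m - i)` times the sum of all smaller-ranked masses (`0` if there is none). -/
def cutoff {n : ℕ} (p : Fin n → ℝ) (m : ℕ) : ℕ :=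
  Nat.findGreatest
    (fun i => 1 / ((m : ℝ) - (i : ℝ)) * ∑ j ∈ Finset.Ico i n, rankedMass p j
      ≤ rankedMass p (i - 1))
    (m - 1)

/-- The probability mass function of `X̃_m` for `X` with probability mass function `p`. -/
def tildeMass {n : ℕ} (p : Fin n → ℝ) (m : ℕ) (i : Fin m) : ℝ :=
  if rankedMass p 0 < 1 / (m : ℝ) then 1 / (m : ℝ)
  else if (i : ℕ) < cutoff p m then rankedMass p i
  else 1 / ((m : ℝ) - (cutoff p m : ℝ)) * ∑ j ∈ Finset.Ico (cutoff p m) n, rankedMass p j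

/-- `HuffmanReachable p C`: starting from the singletons of `{1, …, n}`, the family of blocks `C`
is obtained by successively merging two blocks of smallest masses (ties broken arbitrarily). -/
inductive HuffmanReachable {n : ℕ} (p : Fin n → ℝ) : Finset (Finset (Fin n)) → Prop
  | start : HuffmanReachable p (Finset.univ.image fun x => {x})
  | merge (C : Finset (Finset (Fin n))) (A B : Finset (Fin n)) :
      HuffmanReachable p C → A ∈ C → B ∈ C → A ≠ B →
      (∀ D ∈ C, D ≠ A → D ≠ B →
        ∑ x ∈ A, p x ≤ ∑ x ∈ D, p x ∧ ∑ x ∈ B, p x ≤ ∑ x ∈ D, p x) →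
      HuffmanReachable p (insert (A ∪ B) ((C.erase A).erase B))

/-- `f` is a function `f*` produced by the Huffman procedure: merging is stopped when exactly `m`
blocks are left; these blocks, numbered in decreasing order of their masses, are the fibres
of `f`. -/
def IsHuffmanMap {n m : ℕ} (p : Fin n → ℝ) (f : Fin n → Fin m) : Prop :=
  ∃ C : Finset (Finset (Fin n)), HuffmanReachable p C ∧ C.card = m ∧
    (Finset.univ.image fun j : Fin m => Finset.univ.filter fun x => f x = j) = C ∧
    Antitone fun j : Fin m => ∑ x ∈ Finset.univ.filter (fun x => f x = j), p x

/-- `X 1, …, X k` are i.i.d. random variables with probability mass function `p`. -/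
structure IsIIDSample {Ω : Type*} [MeasurableSpace Ω] (μ : Measure Ω) {n k : ℕ}
    (p : Fin n → ℝ) (X : Fin k → Ω → Fin n) : Prop where
  measurable : ∀ i, Measurable (X i)
  indep : iIndepFun X μ
  law : ∀ i x, μ.real (X i ⁻¹' {x}) = p x

/-- `g` is a ranking function of the random variable `Z`: it enumerates the alphabet by
`1, …, |A|` in decreasing order of the probabilities (ties broken arbitrarily). -/
structure IsRankingFunction {Ω : Type*} [MeasurableSpace Ω] (μ : Measure Ω)
    {A : Type*} [Fintype A] (Z : Ω → A) (g : A → ℕ) : Prop where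
  bijOn : Set.BijOn g Set.univ (Set.Icc 1 (Fintype.card A))
  lt_of_prob_lt : ∀ x y, μ.real (Z ⁻¹' {y}) < μ.real (Z ⁻¹' {x}) → g x < g y

/-- `(1/k) log_b (E[g^ρ(X^k)] / E[h^ρ(Y^k)])` where `Y i = f (X i)`. -/
def guessingReduction {Ω : Type*} [MeasurableSpace Ω] (μ : Measure Ω) {n m k : ℕ} (b ρ : ℝ)
    (X : Fin k → Ω → Fin n) (f : Fin n → Fin m)
    (g : (Fin k → Fin n) → ℕ) (h : (Fin k → Fin m) → ℕ) : ℝ :=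
  1 / (k : ℝ) * Real.logb b
    ((∫ ω, (g (fun i => X i ω) : ℝ) ^ ρ ∂μ) / (∫ ω, (h (fun i => f (X i ω)) : ℝ) ^ ρ ∂μ))

/-- The lower bound on the reduction of the guessing moments. -/
def lowerBound {n : ℕ} (b : ℝ) (p : Fin n → ℝ) (m : ℕ) (ρ : ℝ) (k : ℕ) : ℝ :=
  ρ * (renyiEntropy b (1 / (1 + ρ)) p - renyiEntropy b (1 / (1 + ρ)) (tildeMass p m))
    - ρ * Real.logb b (1 + k * Real.log n) / k

/-- The upper bound on the reduction of the guessing moments. -/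
def upperBound {n : ℕ} (b : ℝ) (p : Fin n → ℝ) (m : ℕ) (ρ : ℝ) (k : ℕ) : ℝ :=
  ρ * (renyiEntropy b (1 / (1 + ρ)) p - renyiEntropy b (1 / (1 + ρ)) (tildeMass p m)
      + v b (1 / (1 + ρ)))
    + ρ * Real.logb b (1 + k * Real.log m) / k

end Guessing

end

/-! Put `α = 1 / (1 + ρ)`. Arikan's inequalities pin a guessing moment between `(∑ P ^ α) ^ (1 + ρ)`
and the same quantity divided by `(1 + log |A|) ^ ρ`. For an i.i.d. vector the inner sum is a `k`-th
power, and `(1 + ρ) * log ∑ p ^ α = ρ * H_α`. So, up to the logarithmic terms, both bounds reduce to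
a one-letter comparison of `∑ q ^ α` with the corresponding sum for `X̃_m`, where `q` is the law of
`f(X)`.

For the lower bound, lumping only increases sums of largest masses, so `q` majorizes the law of
`X̃_m`; concavity of `x ↦ x ^ α` concludes (`sum_rpow_fiberMass_le`).

For the upper bound, let `w` be the mass of the last block formed by the Huffman procedure. Blocks
heavier than `w` are unmerged singletons, and all others have mass in `[w / 2, w]`
(`HuffmanReachable.exists_threshold`). On that interval `x ^ α` lies above its chord, and the chord
lies above `huffmanRatio α` times the `α`-th power. Hence the light blocks lose at most this factor
against their equalized version, whose sum together with the heavy masses dominates that of `X̃_m`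
(`huffmanRatio_mul_le_sum_rpow_fiberMass`). The logarithm of the factor is `-(1 - α) * v`.

The numerical value comes from `2 ^ x - 1 = 2 * exp t * sinh t` with `t = x * log 2 / 2` and the
expansion `log (sinh t / t) ≈ t ^ 2 / 6`: the main term of `ρ * v` in bits is `(log 2 / 8) * ρ / (1
+ ρ)`, with an explicit error bound. -/

namespace Guessing

/-! ### Decreasing rearrangement of the masses. -/

section RankedMass

variable {n : ℕ} {p : Fin n → ℝ}

lemma rankedMass_nonneg (hp : ∀ x, 0 ≤ p x) (i : ℕ) : 0 ≤ rankedMass p i := by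
  unfold rankedMass
  split_ifs
  · exact hp _
  · exact le_rfl

lemma rankedMass_antitone (hp : ∀ x, 0 ≤ p x) : Antitone (rankedMass p) := by
  intro i j hij
  by_cases hj : j < n
  · have hi : i < n := lt_of_le_of_lt hij hj
    have h := Tuple.monotone_sort (fun a => - p a)
      (show (⟨i, hi⟩ : Fin n) ≤ ⟨j, hj⟩ from hij)
    simp only [Function.comp_apply, neg_le_neg_iff] at h
    simpa [rankedMass, hi, hj] using h
  · have : rankedMass p j = 0 := by simp [rankedMass, hj]
    rw [this]
    exact rankedMass_nonneg hp i

lemma rankedMass_coe (i : Fin n) :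
    rankedMass p i = p (Tuple.sort (fun a => - p a) i) := by
  simp [rankedMass]

lemma sum_comp_rankedMass (F : ℝ → ℝ) :
    ∑ i ∈ Finset.range n, F (rankedMass p i) = ∑ x, F (p x) := by
  rw [Finset.sum_range]
  simp only [rankedMass_coe]
  exact Equiv.sum_comp (Tuple.sort (fun a => - p a)) (fun x => F (p x))

/-- The maximum of a finite set of naturals is at least the number of its other elements, so moving
it down to that index does not decrease `a`. -/
lemma sum_le_sum_range_card {a : ℕ → ℝ} (ha : Antitone a) (K : Finset ℕ) :
    ∑ i ∈ K, a i ≤ ∑ i ∈ Finset.range K.card, a i := by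
  induction K using Finset.induction_on_max with
  | empty => simp
  | insert x s hx ih =>
    have hxs : x ∉ s := fun h => lt_irrefl _ (hx x h)
    rw [Finset.sum_insert hxs, Finset.card_insert_of_notMem hxs, Finset.sum_range_succ]
    have : s.card ≤ x := by
      have : s ⊆ Finset.range x := fun y hy => Finset.mem_range.2 (hx y hy)
      simpa using Finset.card_le_card this
    linarith [ha this]

lemma sum_le_sum_rankedMass (hp : ∀ x, 0 ≤ p x) (J : Finset (Fin n)) :
    ∑ x ∈ J, p x ≤ ∑ i ∈ Finset.range J.card, rankedMass p i := by
  classical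
  set σ := Tuple.sort (fun a => - p a) with hσ
  have hinj : Function.Injective fun x : Fin n => ((σ.symm x : Fin n) : ℕ) :=
    Fin.val_injective.comp σ.symm.injective
  have h := sum_le_sum_range_card (rankedMass_antitone hp) (J.image fun x => ((σ.symm x : Fin n) : ℕ))
  rw [Finset.card_image_of_injective _ hinj, Finset.sum_image hinj.injOn] at h
  simpa [rankedMass_coe, ← hσ] using h

lemma exists_card_eq_sum_rankedMass (k : ℕ) (hk : k ≤ n) :
    ∃ J : Finset (Fin n), J.card = k ∧ ∑ x ∈ J, p x = ∑ i ∈ Finset.range k, rankedMass p i := by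
  classical
  have hinj : Function.Injective
      fun i : Fin k => Tuple.sort (fun a => - p a) (Fin.castLE hk i) :=
    (Equiv.injective _).comp (Fin.castLE_injective hk)
  refine ⟨Finset.univ.image fun i : Fin k => Tuple.sort (fun a => - p a) (Fin.castLE hk i),
    ?_, ?_⟩
  · rw [Finset.card_image_of_injective _ hinj]; simp
  · rw [Finset.sum_image hinj.injOn, Finset.sum_range]
    refine Finset.sum_congr rfl fun i _ => ?_
    rw [← rankedMass_coe (p := p)]; simp

/-- By monotonicity the ranks of masses above `w` form an initial segment, so their number
determines them. -/
lemma filter_rankedMass_gt (hp : ∀ x, 0 ≤ p x) (w : ℝ) :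
    (Finset.range n).filter (fun i => w < rankedMass p i)
      = Finset.range (Finset.univ.filter fun x => w < p x).card := by
  classical
  set S := (Finset.range n).filter (fun i => w < rankedMass p i) with hS
  have hcard : S.card = (Finset.univ.filter fun x => w < p x).card := by
    have h := sum_comp_rankedMass (p := p) (fun y => if w < y then (1 : ℝ) else 0)
    simp only [Finset.sum_boole] at h
    exact_mod_cast h
  rw [← hcard]
  have hdown : ∀ i ∈ S, ∀ j ≤ i, j ∈ S := by
    intro i hi j hj
    simp only [hS, Finset.mem_filter, Finset.mem_range] at hi ⊢
    exact ⟨by omega, hi.2.trans_le (rankedMass_antitone hp hj)⟩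
  refine Finset.eq_of_subset_of_card_le (fun i hi => ?_) (by simp)
  rw [Finset.mem_range]
  have : Finset.range (i + 1) ⊆ S := fun j hj =>
    hdown i hi j (by simp at hj; omega)
  simpa using Finset.card_le_card this

lemma sum_filter_gt_eq_sum_rankedMass (hp : ∀ x, 0 ≤ p x) (w : ℝ) (F : ℝ → ℝ) :
    ∑ x with w < p x, F (p x)
      = ∑ i ∈ Finset.range (Finset.univ.filter fun x => w < p x).card, F (rankedMass p i) := by
  rw [← filter_rankedMass_gt hp, Finset.sum_filter, Finset.sum_filter]
  exact (sum_comp_rankedMass (fun y => if w < y then F y else 0)).symm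

end RankedMass

/-- The mass function of `f(X)` for `X` with mass function `p`. -/
noncomputable def fiberMass {n m : ℕ} (p : Fin n → ℝ) (f : Fin n → Fin m) (j : Fin m) : ℝ :=
  ∑ x with f x = j, p x

/-! ### Majorization by lumped laws, and the lower bound on their power sums. -/

section Majorization

variable {n m : ℕ} {p : Fin n → ℝ} {f : Fin n → Fin m}

lemma fiberMass_nonneg (hp : ∀ x, 0 ≤ p x) (j : Fin m) : 0 ≤ fiberMass p f j :=
  Finset.sum_nonneg fun x _ => hp x

lemma sum_fiberMass : ∑ j, fiberMass p f j = ∑ x, p x :=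
  Finset.sum_fiberwise _ _ _

lemma le_fiberMass (hp : ∀ x, 0 ≤ p x) (x : Fin n) : p x ≤ fiberMass p f (f x) :=
  Finset.single_le_sum (f := p) (fun y _ => hp y) (by simp)

/-- The `k` heaviest symbols lie in at most `k` fibres, whose total mass is at least theirs. -/
lemma sum_rankedMass_le_fiberMass (hp : ∀ x, 0 ≤ p x) (k : ℕ) (hk : k ≤ n) :
    ∑ i ∈ Finset.range k, rankedMass p i
      ≤ ∑ i ∈ Finset.range k, rankedMass (fiberMass p f) i := by
  classical
  obtain ⟨J, hJ, hsum⟩ := exists_card_eq_sum_rankedMass (p := p) k hk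
  have hq : ∀ j, 0 ≤ fiberMass p f j := fiberMass_nonneg hp
  calc ∑ i ∈ Finset.range k, rankedMass p i = ∑ x ∈ J, p x := hsum.symm
    _ ≤ ∑ j ∈ J.image f, fiberMass p f j := by
        rw [← Finset.sum_fiberwise_of_maps_to (s := J) (t := J.image f) (g := f)
          (fun x hx => Finset.mem_image_of_mem f hx)]
        refine Finset.sum_le_sum fun j _ => ?_
        exact Finset.sum_le_sum_of_subset_of_nonneg
          (Finset.filter_subset_filter _ (Finset.subset_univ _)) (fun x _ _ => hp x)
    _ ≤ _ := sum_le_sum_rankedMass hq _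
    _ ≤ _ := by
        refine Finset.sum_le_sum_of_subset_of_nonneg ?_ fun i _ _ => rankedMass_nonneg hq i
        exact Finset.range_subset_range.2 (hJ ▸ Finset.card_image_le)

/-- Abel summation, in a form that survives induction: the prefix sum is carried along with the
smallest weight used so far. -/
lemma sum_mul_nonneg_of_prefix_nonneg {u d : ℕ → ℝ} (hua : Antitone u) (N : ℕ)
    (hd : ∀ k ≤ N, 0 ≤ ∑ i ∈ Finset.range k, d i) :
    u (N - 1) * ∑ i ∈ Finset.range N, d i ≤ ∑ i ∈ Finset.range N, u i * d i := by
  induction N with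
  | zero => simp
  | succ N ih =>
    have ih' := ih fun k hk => hd k (by omega)
    rw [Finset.sum_range_succ, Finset.sum_range_succ, mul_add]
    have h1 : u N * ∑ i ∈ Finset.range N, d i ≤ u (N - 1) * ∑ i ∈ Finset.range N, d i :=
      mul_le_mul_of_nonneg_right (hua (by omega)) (hd N (by omega))
    simp only [Nat.add_sub_cancel]
    linarith

lemma sum_rpow_le_of_avg {ι : Type*} (s : Finset ι) (hs : s.Nonempty) {α : ℝ} (h0 : 0 ≤ α) (h1 : α ≤ 1)
    {x : ι → ℝ} (hx : ∀ i ∈ s, 0 ≤ x i) :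
    ∑ i ∈ s, x i ^ α ≤ s.card * ((∑ i ∈ s, x i) / s.card) ^ α := by
  have hc : (0 : ℝ) < s.card := by exact_mod_cast hs.card_pos
  have h := (Real.concaveOn_rpow h0 h1).le_map_sum (t := s) (w := fun _ => (1 : ℝ) / s.card)
    (p := x) (fun _ _ => by positivity) (by simp [hc.ne']) (fun i hi => hx i hi)
  simp only [smul_eq_mul, ← Finset.mul_sum] at h
  rw [one_div, inv_mul_le_iff₀ hc] at h
  rwa [div_eq_inv_mul]

lemma add_rpow_le_tangent {α : ℝ} (h0 : 0 < α) (h1 : α < 1) {x y : ℝ} (hx : 0 ≤ x) (hy : 0 < y) :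
    x ^ α ≤ y ^ α + α * y ^ (α - 1) * (x - y) := by
  have h := rpow_one_add_le_one_add_mul_self (s := x / y - 1) (p := α)
    (by have := div_nonneg hx hy.le; linarith) h0.le h1.le
  have e : x = y * (1 + (x / y - 1)) := by field_simp; ring
  have hn : 0 ≤ 1 + (x / y - 1) := by have := div_nonneg hx hy.le; linarith
  calc x ^ α = y ^ α * (1 + (x / y - 1)) ^ α := by
        rw [← Real.mul_rpow hy.le hn, ← e]
    _ ≤ y ^ α * (1 + α * (x / y - 1)) := by gcongr
    _ = _ := by
        rw [Real.rpow_sub_one hy.ne']; field_simp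

/-- Karamata's inequality for `x ↦ x ^ α` and a target that is constant from the index `N` on. -/
lemma sum_rpow_le_of_majorizes {α : ℝ} (h0 : 0 < α) (h1 : α < 1) {s t : ℕ → ℝ} (hs : ∀ i, 0 ≤ s i)
    (ht : ∀ i, 0 ≤ t i) (hta : Antitone t) (N M : ℕ) (hNM : N ≤ M) {c : ℝ} (hc : ∀ i, N ≤ i → t i = c)
    (hpre : ∀ k ≤ N, ∑ i ∈ Finset.range k, t i ≤ ∑ i ∈ Finset.range k, s i)
    (hsum : ∑ i ∈ Finset.range M, s i = ∑ i ∈ Finset.range M, t i) :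
    ∑ i ∈ Finset.range M, s i ^ α ≤ ∑ i ∈ Finset.range M, t i ^ α := by
  have c0 : 0 ≤ c := hc N le_rfl ▸ ht N
  -- The slope of `x ^ α` is infinite at `0`, so all masses are shifted by `ε > 0` and the limit `ε
  -- → 0` is taken at the end.
  have key : ∀ ε : ℝ, 0 < ε →
      ∑ i ∈ Finset.range M, (s i + ε) ^ α ≤ ∑ i ∈ Finset.range M, (t i + ε) ^ α := by
    intro ε hε
    set W : ℝ → ℝ := fun y => α * (y + ε) ^ (α - 1) with hW
    have hWanti : ∀ x y, 0 ≤ x → x ≤ y → W y ≤ W x := fun x y hx hxy => by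
      exact mul_le_mul_of_nonneg_left
        (Real.rpow_le_rpow_of_nonpos (by linarith) (by linarith) (by linarith)) h0.le
    have htc : ∀ i, c ≤ t i := fun i => by
      rcases le_total N i with h | h
      · exact (hc i h).ge
      · exact (hc N le_rfl) ▸ hta h
    have step1 : ∑ i ∈ Finset.range M, (s i + ε) ^ α
        ≤ ∑ i ∈ Finset.range M, (t i + ε) ^ α
          + ∑ i ∈ Finset.range M, W (t i) * (s i - t i) := by
      rw [← Finset.sum_add_distrib]
      refine Finset.sum_le_sum fun i _ => ?_
      have := add_rpow_le_tangent h0 h1 (x := s i + ε) (y := t i + ε)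
        (by linarith [hs i]) (by linarith [ht i])
      simpa [hW] using this
    -- As the totals agree, the constant `W c` may be subtracted from the slopes. The new weights
    -- are nonnegative and decreasing and vanish from `N` on, so only prefixes of length at most `N`
    -- matter.
    have step2 : ∑ i ∈ Finset.range M, W (t i) * (s i - t i)
        = - ∑ i ∈ Finset.range M, (W c - W (t i)) * (s i - t i) := by
      rw [← Finset.sum_neg_distrib, ← sub_eq_zero, ← Finset.sum_sub_distrib]
      have : ∑ i ∈ Finset.range M, W c * (s i - t i) = 0 := by
        rw [← Finset.mul_sum, Finset.sum_sub_distrib, hsum]; simp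
      rw [← this]
      exact Finset.sum_congr rfl fun i _ => by ring
    have step3 : ∑ i ∈ Finset.range M, (W c - W (t i)) * (s i - t i)
        = ∑ i ∈ Finset.range N, (W c - W (t i)) * (s i - t i) := by
      symm
      refine Finset.sum_subset (Finset.range_subset_range.2 hNM) fun i _ hi => ?_
      rw [hc i (by simpa using hi)]; ring
    have hu : ∀ i, 0 ≤ W c - W (t i) := fun i => sub_nonneg.2 (hWanti _ _ c0 (htc i))
    have hd : ∀ k ≤ N, 0 ≤ ∑ i ∈ Finset.range k, (s i - t i) := fun k hk => by
      rw [Finset.sum_sub_distrib]; linarith [hpre k hk]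
    have step4 := sum_mul_nonneg_of_prefix_nonneg (u := fun i => W c - W (t i))
      (d := fun i => s i - t i)
      (fun i j hij => by have := hWanti _ _ (ht j) (hta hij); linarith) N hd
    have := mul_nonneg (hu (N - 1)) (hd N le_rfl)
    linarith
  have lim : ∀ x : ℕ → ℝ, Tendsto (fun ε : ℝ => ∑ i ∈ Finset.range M, (x i + ε) ^ α) (𝓝[>] 0)
      (𝓝 (∑ i ∈ Finset.range M, x i ^ α)) := fun x => by
    have hcont : Continuous fun ε : ℝ => ∑ i ∈ Finset.range M, (x i + ε) ^ α :=
      continuous_finsetSum _ fun i _ =>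
        (continuous_const.add continuous_id).rpow_const fun _ => Or.inr h0.le
    simpa using (hcont.tendsto 0).mono_left nhdsWithin_le_nhds
  exact le_of_tendsto_of_tendsto (lim s) (lim t)
    (eventually_nhdsWithin_of_forall fun ε hε => key ε hε)

/-- The masses of rank larger than `i`, averaged over `m - i` places. -/
noncomputable def tailMean {n : ℕ} (p : Fin n → ℝ) (m i : ℕ) : ℝ :=
  1 / ((m : ℝ) - (i : ℝ)) * ∑ j ∈ Finset.Ico i n, rankedMass p j

lemma cutoff_lt (hm : 2 ≤ m) : cutoff p m < m := by
  have : cutoff p m ≤ m - 1 := Nat.findGreatest_le _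
  omega

lemma sum_Ico_rankedMass (hp1 : ∑ x, p x = 1) {i : ℕ} (hi : i ≤ n) :
    ∑ j ∈ Finset.Ico i n, rankedMass p j = 1 - ∑ j ∈ Finset.range i, rankedMass p j := by
  have h := sum_comp_rankedMass (p := p) (fun y => y)
  rw [hp1, ← Finset.sum_range_add_sum_Ico _ hi] at h
  linarith

lemma cutoff_spec (hm : 2 ≤ m) (hmn : m < n) (hp1 : ∑ x, p x = 1)
    (h : 1 / (m : ℝ) ≤ rankedMass p 0) :
    1 ≤ cutoff p m ∧ tailMean p m (cutoff p m) ≤ rankedMass p (cutoff p m - 1) := by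
  have hm' : (2 : ℝ) ≤ m := by exact_mod_cast hm
  -- The index `1` is admissible: `p₁ ≥ 1 / m` is equivalent to `p₁ ≥ (1 - p₁) / (m - 1)`.
  have h1 : tailMean p m 1 ≤ rankedMass p (1 - 1) := by
    unfold tailMean
    rw [sum_Ico_rankedMass hp1 (by omega)]
    simp only [Finset.range_one, Finset.sum_singleton, Nat.cast_one, Nat.sub_self]
    rw [one_div, inv_mul_le_iff₀ (by linarith)]
    rw [div_le_iff₀ (by linarith)] at h
    linarith
  refine ⟨Nat.le_findGreatest (by omega) h1, ?_⟩
  exact Nat.findGreatest_spec (P := fun i => tailMean p m i ≤ rankedMass p (i - 1))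
    (show 1 ≤ m - 1 by omega) h1

/-- The masses of `X̃_m` for `p₁ ≥ 1 / m`, as a sequence. -/
noncomputable def tildeSeq {n : ℕ} (p : Fin n → ℝ) (m i : ℕ) : ℝ :=
  if i < cutoff p m then rankedMass p i else tailMean p m (cutoff p m)

lemma tailMean_nonneg (hp : ∀ x, 0 ≤ p x) {i : ℕ} (hi : i < m) : 0 ≤ tailMean p m i := by
  have : (i : ℝ) < m := by exact_mod_cast hi
  exact mul_nonneg (by rw [one_div, inv_nonneg]; linarith)
    (Finset.sum_nonneg fun j _ => rankedMass_nonneg hp j)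

lemma tildeMass_eq_tildeSeq (h : 1 / (m : ℝ) ≤ rankedMass p 0) (i : Fin m) :
    tildeMass p m i = tildeSeq p m i := by
  rw [tildeMass, if_neg (not_lt.2 h)]
  rfl

lemma sum_tildeSeq_Ico (hm : 2 ≤ m) (hmn : m < n) {i : ℕ} (hi : i ≤ cutoff p m) :
    ∑ j ∈ Finset.Ico i m, tildeSeq p m j = ∑ j ∈ Finset.Ico i n, rankedMass p j := by
  have hc := cutoff_lt (p := p) hm
  have hc' : (cutoff p m : ℝ) < m := by exact_mod_cast hc
  rw [← Finset.sum_Ico_consecutive _ hi hc.le,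
    ← Finset.sum_Ico_consecutive (rankedMass p) hi (by omega : cutoff p m ≤ n)]
  congr 1
  · refine Finset.sum_congr rfl fun j hj => ?_
    simp [tildeSeq, (Finset.mem_Ico.1 hj).2]
  · rw [Finset.sum_congr rfl (g := fun _ => tailMean p m (cutoff p m))
      (fun j hj => by simp [tildeSeq, not_lt.2 (Finset.mem_Ico.1 hj).1])]
    simp only [Finset.sum_const, Nat.card_Ico, nsmul_eq_mul, tailMean]
    rw [Nat.cast_sub hc.le]
    field_simp [sub_ne_zero.2 hc'.ne']

theorem sum_rpow_fiberMass_le (hm : 2 ≤ m) (hmn : m < n) (hp : ∀ x, 0 ≤ p x) (hp1 : ∑ x, p x = 1)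
    (f : Fin n → Fin m) {α : ℝ} (h0 : 0 < α) (h1 : α < 1) :
    ∑ j, fiberMass p f j ^ α ≤ ∑ i, tildeMass p m i ^ α := by
  have hq : ∀ j, 0 ≤ fiberMass p f j := fiberMass_nonneg hp
  have hq1 : ∑ j, fiberMass p f j = 1 := sum_fiberMass.trans hp1
  rcases lt_or_ge (rankedMass p 0) (1 / (m : ℝ)) with h | h
  · have := sum_rpow_le_of_avg Finset.univ ⟨⟨0, by omega⟩, Finset.mem_univ _⟩ h0.le h1.le
      (fun j _ => hq j)
    simpa only [tildeMass, h, hq1, if_true, Finset.card_univ, Fintype.card_fin, Finset.sum_const,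
      nsmul_eq_mul] using this
  · obtain ⟨hc1, hcle⟩ := cutoff_spec hm hmn hp1 h
    have hc := cutoff_lt (p := p) hm
    have hr := rankedMass_antitone hp
    have hs : ∑ i, tildeMass p m i ^ α = ∑ i ∈ Finset.range m, tildeSeq p m i ^ α := by
      rw [Finset.sum_range]
      simp only [tildeMass_eq_tildeSeq h]
    rw [hs, ← sum_comp_rankedMass (fun y => y ^ α)]
    refine sum_rpow_le_of_majorizes h0 h1 (rankedMass_nonneg hq) (fun i => ?_) ?_
      (cutoff p m) m hc.le (c := tailMean p m (cutoff p m)) (fun i hi => ?_) (fun k hk => ?_) ?_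
    · unfold tildeSeq
      split_ifs
      · exact rankedMass_nonneg hp i
      · exact tailMean_nonneg hp hc
    · intro i j hij
      unfold tildeSeq
      split_ifs with h2 h3 h3
      · exact hr hij
      · omega
      · exact hcle.trans (hr (by omega))
      · exact le_rfl
    · simp [tildeSeq, not_lt.2 hi]
    · refine le_trans (le_of_eq ?_) (sum_rankedMass_le_fiberMass hp k (by omega))
      refine Finset.sum_congr rfl fun i hi => ?_
      have : i < cutoff p m := by simp at hi; omega
      simp [tildeSeq, this]
    · rw [sum_comp_rankedMass (fun y => y), hq1]
      have := sum_tildeSeq_Ico (p := p) hm hmn (i := 0) (Nat.zero_le _)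
      simp only [Nat.Ico_zero_eq_range] at this
      rw [this, sum_comp_rankedMass (fun y => y), hp1]

end Majorization

/-- `huffmanRatio α = b ^ (-(1 - α) * v b α)` for every base `b`. -/
noncomputable def huffmanRatio (α : ℝ) : ℝ :=
  ((2 - 2 ^ α) / (1 - α)) ^ (1 - α) * ((2 ^ α - 1) / α) ^ α

/-! ### The loss factor: chords of `x ^ α` on `[w / 2, w]`. -/

section HuffmanRatio

variable {α : ℝ}

lemma one_lt_two_rpow (h0 : 0 < α) : (1 : ℝ) < 2 ^ α :=
  Real.one_lt_rpow (by norm_num) h0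

lemma two_rpow_lt_two (h1 : α < 1) : (2 : ℝ) ^ α < 2 := by
  simpa using Real.rpow_lt_rpow_of_exponent_lt (by norm_num : (1 : ℝ) < 2) h1

lemma huffmanRatio_pos (h0 : 0 < α) (h1 : α < 1) : 0 < huffmanRatio α := by
  have := one_lt_two_rpow h0
  have := two_rpow_lt_two h1
  have e1 : 0 < (2 - 2 ^ α) / (1 - α) := div_pos (by linarith) (by linarith)
  have e2 : 0 < (2 ^ α - 1) / α := div_pos (by linarith) h0
  unfold huffmanRatio
  positivity

lemma logb_huffmanRatio (b : ℝ) (h0 : 0 < α) (h1 : α < 1) :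
    Real.logb b (huffmanRatio α) = -((1 - α) * v b α) := by
  have := one_lt_two_rpow h0
  have := two_rpow_lt_two h1
  have e1 : 0 < (2 - 2 ^ α) / (1 - α) := div_pos (by linarith) (by linarith)
  have e2 : 0 < (2 ^ α - 1) / α := div_pos (by linarith) h0
  have i1 : (α - 1) / (2 ^ α - 2) = ((2 - 2 ^ α) / (1 - α))⁻¹ := by
    rw [inv_div, ← neg_div_neg_eq, neg_sub, neg_sub]
  have i2 : α / (2 ^ α - 1) = ((2 ^ α - 1) / α)⁻¹ := by rw [inv_div]
  have h3 : α - 1 ≠ 0 := by linarith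
  rw [v, if_neg h1.ne, i1, i2, Real.logb_inv, Real.logb_inv, huffmanRatio,
    Real.logb_mul (by positivity) (by positivity), Real.logb_rpow_eq_mul_logb_of_pos e1,
    Real.logb_rpow_eq_mul_logb_of_pos e2]
  field_simp
  ring

/-- The right side is the chord of `r ^ α` through `r = 1 / 2` and `r = 1`. Weighted AM–GM with
weights `1 - α` and `α`, applied to its constant and linear parts divided by their weights, gives
the factor; the powers of `2 ^ α` cancel. -/
lemma huffmanRatio_mul_rpow_le (h0 : 0 < α) (h1 : α < 1) {r : ℝ} (hr : 0 ≤ r) :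
    huffmanRatio α * r ^ α ≤ (2 / 2 ^ α - 1) + (2 - 2 / 2 ^ α) * r := by
  have hu1 := one_lt_two_rpow h0
  have hu2 := two_rpow_lt_two h1
  have hK : huffmanRatio α = ((2 - 2 ^ α) / (1 - α)) ^ (1 - α) * ((2 ^ α - 1) / α) ^ α := rfl
  set u : ℝ := 2 ^ α with hu
  have u0 : 0 < u := by linarith
  have e1 : 0 ≤ (2 - u) / (1 - α) := div_nonneg (by linarith) (by linarith)
  have e2 : 0 ≤ (u - 1) / α := div_nonneg (by linarith) h0.le
  have h := Real.geom_mean_le_arith_mean2_weighted (w₁ := 1 - α) (w₂ := α)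
    (p₁ := (2 - u) / (1 - α) * u⁻¹) (p₂ := (u - 1) / α * (2 / u * r))
    (by linarith) h0.le (by positivity) (by positivity) (by ring)
  rw [Real.mul_rpow e1 (by positivity), Real.mul_rpow e2 (by positivity),
    Real.mul_rpow (by positivity) hr, Real.div_rpow (by norm_num) u0.le, ← hu,
    Real.inv_rpow u0.le, Real.rpow_sub u0, Real.rpow_one] at h
  have h3 : 1 - α ≠ 0 := by linarith
  have hua : 0 < u ^ α := by positivity
  calc huffmanRatio α * r ^ α = _ := by
        rw [hK]; field_simp
    _ ≤ _ := h
    _ = _ := by field_simp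

lemma huffmanRatio_le_one (h0 : 0 < α) (h1 : α < 1) : huffmanRatio α ≤ 1 := by
  have := huffmanRatio_mul_rpow_le h0 h1 (zero_le_one)
  simp only [Real.one_rpow, mul_one] at this
  linarith

lemma chord_le_rpow (h0 : 0 < α) (h1 : α < 1) {w x : ℝ} (hw : 0 < w) (hx1 : w ≤ 2 * x) (hx2 : x ≤ w) :
    w ^ α * ((2 / 2 ^ α - 1) + (2 - 2 / 2 ^ α) * (x / w)) ≤ x ^ α := by
  have hθ1 : 1 / 2 ≤ x / w := by rw [le_div_iff₀ hw]; linarith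
  have hθ2 : x / w ≤ 1 := by rw [div_le_iff₀ hw]; linarith
  have h := (Real.concaveOn_rpow h0.le h1.le).right (Set.mem_Ici.2 (half_pos hw).le)
    (Set.mem_Ici.2 hw.le) (show 0 ≤ 2 - 2 * (x / w) by linarith)
    (show 0 ≤ 2 * (x / w) - 1 by linarith) (by ring)
  simp only [smul_eq_mul] at h
  have e : (2 - 2 * (x / w)) * (w / 2) + (2 * (x / w) - 1) * w = x := by field_simp; ring
  rw [e, Real.div_rpow hw.le (by norm_num)] at h
  refine le_trans (le_of_eq ?_) h
  have : (0 : ℝ) < 2 ^ α := by positivity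
  field_simp
  ring

/-- Each term lies above the chord, and the sum of chord values depends only on the mean, where the
chord dominates `huffmanRatio α` times the power. -/
lemma huffmanRatio_mul_le_sum_rpow (h0 : 0 < α) (h1 : α < 1) {ι : Type*} (s : Finset ι)
    {x : ι → ℝ} {w : ℝ} (hw : 0 ≤ w) (hx1 : ∀ i ∈ s, w ≤ 2 * x i) (hx2 : ∀ i ∈ s, x i ≤ w) :
    huffmanRatio α * (s.card * ((∑ i ∈ s, x i) / s.card) ^ α) ≤ ∑ i ∈ s, x i ^ α := by
  rcases s.eq_empty_or_nonempty with rfl | hs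
  · simp
  have hc : (0 : ℝ) < s.card := by exact_mod_cast hs.card_pos
  have hx0 : ∀ i ∈ s, 0 ≤ x i := fun i hi => by linarith [hx1 i hi]
  rcases hw.eq_or_lt with rfl | hw
  · have : ∑ i ∈ s, x i = 0 := le_antisymm (Finset.sum_nonpos hx2) (Finset.sum_nonneg hx0)
    rw [this, zero_div, Real.zero_rpow h0.ne', mul_zero, mul_zero]
    exact Finset.sum_nonneg fun i hi => Real.rpow_nonneg (hx0 i hi) _
  · obtain ⟨c, hcdef⟩ : ∃ c, c = (∑ i ∈ s, x i) / s.card := ⟨_, rfl⟩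
    have hc0 : 0 ≤ c := hcdef ▸ div_nonneg (Finset.sum_nonneg hx0) hc.le
    have hsum : ∑ i ∈ s, x i = s.card * c := by rw [hcdef, mul_div_cancel₀ _ hc.ne']
    rw [← hcdef]
    have hwα : 0 < w ^ α := Real.rpow_pos_of_pos hw α
    calc huffmanRatio α * (s.card * c ^ α)
        = s.card * w ^ α * (huffmanRatio α * (c / w) ^ α) := by
          rw [Real.div_rpow hc0 hw.le]
          linear_combination (-(huffmanRatio α * s.card)) * mul_div_cancel₀ (c ^ α) hwα.ne'
      _ ≤ s.card * w ^ α * ((2 / 2 ^ α - 1) + (2 - 2 / 2 ^ α) * (c / w)) := by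
          exact mul_le_mul_of_nonneg_left
            (huffmanRatio_mul_rpow_le h0 h1 (div_nonneg hc0 hw.le)) (mul_nonneg hc.le hwα.le)
      _ = ∑ i ∈ s, w ^ α * ((2 / 2 ^ α - 1) + (2 - 2 / 2 ^ α) * (x i / w)) := by
          rw [← Finset.mul_sum, Finset.sum_add_distrib, ← Finset.mul_sum, ← Finset.sum_div, hsum,
            Finset.sum_const, nsmul_eq_mul]
          ring
      _ ≤ _ := Finset.sum_le_sum fun i hi => chord_le_rpow h0 h1 hw (hx1 i hi) (hx2 i hi)

end HuffmanRatio

/-! ### The Huffman procedure and the reverse inequality. -/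

section Huffman

variable {n m : ℕ} {p : Fin n → ℝ}

/-- The threshold is the mass of the last merged block, initially `0`. Merging `A` and `B` cannot
lower it, since the old one is at most twice either mass. Every untouched block weighs at least as
much as `A` and as `B`, hence at least half the new threshold. -/
lemma HuffmanReachable.exists_threshold (hp : ∀ x, 0 ≤ p x) {C : Finset (Finset (Fin n))}
    (hC : HuffmanReachable p C) :
    ∃ w : ℝ, 0 ≤ w ∧ (∀ D ∈ C, 2 ≤ D.card → ∑ x ∈ D, p x ≤ w) ∧
      ∀ D ∈ C, w ≤ 2 * ∑ x ∈ D, p x := by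
  have hmass : ∀ D : Finset (Fin n), 0 ≤ ∑ x ∈ D, p x := fun D => Finset.sum_nonneg fun x _ => hp x
  induction hC with
  | start =>
    refine ⟨0, le_rfl, fun D hD h2 => ?_, fun D _ => by linarith [hmass D]⟩
    obtain ⟨x, -, rfl⟩ := Finset.mem_image.1 hD
    simp at h2
  | merge C A B _ hA hB _ hmin ih =>
    obtain ⟨w, -, hle, hge⟩ := ih
    have hA2 := hge A hA
    have hB2 := hge B hB
    refine ⟨∑ x ∈ A, p x + ∑ x ∈ B, p x, by linarith [hmass A, hmass B],
      fun D hD h2 => ?_, fun D hD => ?_⟩ <;> rw [Finset.mem_insert] at hD <;>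
      rcases hD with rfl | hD
    · have := Finset.sum_union_inter (s₁ := A) (s₂ := B) (f := p)
      linarith [hmass (A ∩ B)]
    · simp only [Finset.mem_erase] at hD
      linarith [hle D hD.2.2 h2]
    · have h1 := Finset.sum_le_sum_of_subset_of_nonneg (f := p)
        (Finset.subset_union_left (s₁ := A) (s₂ := B)) fun x _ _ => hp x
      have h2 := Finset.sum_le_sum_of_subset_of_nonneg (f := p)
        (Finset.subset_union_right (s₁ := A) (s₂ := B)) fun x _ _ => hp x
      linarith
    · simp only [Finset.mem_erase] at hD
      have := hmin D hD.2.2 hD.2.1 hD.1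
      linarith

lemma HuffmanReachable.partition {C : Finset (Finset (Fin n))} (hC : HuffmanReachable p C) :
    (∀ D ∈ C, D.Nonempty) ∧ (∀ D ∈ C, ∀ E ∈ C, D ≠ E → Disjoint D E) ∧ ∀ x, ∃ D ∈ C, x ∈ D := by
  induction hC with
  | start =>
    refine ⟨fun D hD => ?_, fun D hD E hE hDE => ?_, fun x => ⟨{x}, by simp, by simp⟩⟩
    · obtain ⟨x, -, rfl⟩ := Finset.mem_image.1 hD
      simp
    · obtain ⟨x, -, rfl⟩ := Finset.mem_image.1 hD
      obtain ⟨y, -, rfl⟩ := Finset.mem_image.1 hE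
      simpa using fun h : x = y => hDE (by rw [h])
  | merge C A B _ hA hB _ _ ih =>
    obtain ⟨hne, hdisj, hcov⟩ := ih
    have hnew : ∀ D ∈ (C.erase A).erase B, Disjoint (A ∪ B) D := fun D hD => by
      simp only [Finset.mem_erase] at hD
      rw [Finset.disjoint_union_left]
      exact ⟨hdisj A hA D hD.2.2 (Ne.symm hD.2.1), hdisj B hB D hD.2.2 (Ne.symm hD.1)⟩
    refine ⟨fun D hD => ?_, fun D hD E hE hDE => ?_, fun x => ?_⟩
    · rcases Finset.mem_insert.1 hD with rfl | hD
      · exact (hne A hA).mono Finset.subset_union_left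
      · exact hne D (Finset.mem_of_mem_erase (Finset.mem_of_mem_erase hD))
    · rcases Finset.mem_insert.1 hD with rfl | hD <;> rcases Finset.mem_insert.1 hE with rfl | hE
      · exact absurd rfl hDE
      · exact hnew E hE
      · exact (hnew D hD).symm
      · exact hdisj D (Finset.mem_of_mem_erase (Finset.mem_of_mem_erase hD)) E
          (Finset.mem_of_mem_erase (Finset.mem_of_mem_erase hE)) hDE
    · obtain ⟨D, hD, hx⟩ := hcov x
      by_cases hDA : D = A
      · exact ⟨A ∪ B, by simp, by simp [← hDA, hx]⟩
      by_cases hDB : D = B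
      · exact ⟨A ∪ B, by simp, by simp [← hDB, hx]⟩
      · exact ⟨D, by simp [hDA, hDB, hD], hx⟩

lemma HuffmanReachable.exists_merge {C : Finset (Finset (Fin n))} (hC : HuffmanReachable p C)
    (h2 : 2 ≤ C.card) : ∃ C', HuffmanReachable p C' ∧ C'.card + 1 = C.card := by
  obtain ⟨hne, hdisj, -⟩ := hC.partition
  obtain ⟨A, hA, hAmin⟩ := Finset.exists_min_image C (fun D => ∑ x ∈ D, p x)
    (Finset.card_pos.1 (by omega))
  have hcA := Finset.card_erase_of_mem hA
  obtain ⟨B, hB, hBmin⟩ := Finset.exists_min_image (C.erase A) (fun D => ∑ x ∈ D, p x)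
    (Finset.card_pos.1 (by omega))
  have hcB := Finset.card_erase_of_mem hB
  obtain ⟨hBA, hB'⟩ := Finset.mem_erase.1 hB
  refine ⟨_, .merge C A B hC hA hB' (Ne.symm hBA) fun D hD hDA _ =>
    ⟨hAmin D hD, hBmin D (Finset.mem_erase.2 ⟨hDA, hD⟩)⟩, ?_⟩
  -- The union is a new block: otherwise it would be disjoint from its nonempty part `A`. Hence the
  -- count drops by exactly one.
  have hnotin : A ∪ B ∉ (C.erase A).erase B := fun h => by
    simp only [Finset.mem_erase] at h
    have hd := hdisj A hA _ h.2.2 (Ne.symm h.2.1)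
    rw [Finset.disjoint_union_right] at hd
    exact (hne A hA).ne_empty (Finset.disjoint_self_iff_empty A |>.1 hd.1)
  rw [Finset.card_insert_of_notMem hnotin]
  omega

lemma exists_huffmanReachable_card (p : Fin n → ℝ) {k : ℕ} (hk : 1 ≤ k) (hkn : k ≤ n) :
    ∃ C, HuffmanReachable p C ∧ C.card = k := by
  induction hkn using Nat.decreasingInduction with
  | self =>
    exact ⟨_, .start, by
      rw [Finset.card_image_of_injective _ Finset.singleton_injective]; simp⟩
  | of_succ k hkn ih =>
    obtain ⟨C, hC, hcard⟩ := ih (by omega)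
    obtain ⟨C', hC', hcard'⟩ := hC.exists_merge (by omega)
    exact ⟨C', hC', by omega⟩

theorem exists_isHuffmanMap (p : Fin n → ℝ) (hm : 1 ≤ m) (hmn : m ≤ n) :
    ∃ f : Fin n → Fin m, IsHuffmanMap p f := by
  classical
  obtain ⟨C, hC, hcard⟩ := exists_huffmanReachable_card p hm hmn
  obtain ⟨hne, hdisj, hcov⟩ := hC.partition
  let e₀ : Fin m ≃ C := (C.equivFinOfCardEq hcard).symm
  let M : Fin m → ℝ := fun j => - ∑ x ∈ (e₀ j : Finset (Fin n)), p x
  let e : Fin m ≃ C := (Tuple.sort M).trans e₀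
  have hmem : ∀ x, ∃ j, x ∈ (e j : Finset (Fin n)) := fun x => by
    obtain ⟨D, hD, hx⟩ := hcov x
    exact ⟨e.symm ⟨D, hD⟩, by simpa using hx⟩
  choose f hf using hmem
  have hfib : ∀ j, (Finset.univ.filter fun x => f x = j) = (e j : Finset (Fin n)) := fun j => by
    ext x
    simp only [Finset.mem_filter, Finset.mem_univ, true_and]
    refine ⟨fun h => h ▸ hf x, fun h => ?_⟩
    by_contra hne'
    have hd := hdisj _ (e (f x)).2 _ (e j).2 fun h' => hne' (e.injective (Subtype.ext h'))
    exact Finset.disjoint_left.1 hd (hf x) h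
  refine ⟨f, C, hC, hcard, ?_, fun i j hij => ?_⟩
  · ext D
    simp only [hfib, Finset.mem_image, Finset.mem_univ, true_and]
    exact ⟨fun ⟨j, hj⟩ => hj ▸ (e j).2, fun hD => ⟨e.symm ⟨D, hD⟩, by simp⟩⟩
  · have := Tuple.monotone_sort M hij
    simp only [hfib]
    simpa [M, e] using this

theorem IsHuffmanMap.exists_threshold {f : Fin n → Fin m} (hp : ∀ x, 0 ≤ p x)
    (hf : IsHuffmanMap p f) :
    ∃ w : ℝ, 0 ≤ w ∧ (∀ x y, x ≠ y → f x = f y → fiberMass p f (f x) ≤ w) ∧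
      ∀ j, w ≤ 2 * fiberMass p f j := by
  classical
  obtain ⟨C, hC, -, himg, -⟩ := hf
  obtain ⟨w, hw, hle, hge⟩ := hC.exists_threshold hp
  have hmem : ∀ j, (Finset.univ.filter fun x => f x = j) ∈ C := fun j =>
    himg ▸ Finset.mem_image_of_mem _ (Finset.mem_univ j)
  refine ⟨w, hw, fun x y hxy hfxy => hle _ (hmem _) ?_, fun j => hge _ (hmem j)⟩
  exact Finset.one_lt_card.2 ⟨x, by simp, y, by simp [hfxy], hxy⟩

/-- For `i ≤ n*`, averaging everything of rank above `i` levels the law of `X̃_m` further and so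
raises the power sum. The hypothesis on `i ≥ 1` forces `i ≤ n*` by maximality; in the equiprobable
case it forces `i = 0`. -/
lemma sum_tildeMass_rpow_le (hm : 2 ≤ m) (hmn : m < n) (hp : ∀ x, 0 ≤ p x) (hp1 : ∑ x, p x = 1)
    {α : ℝ} (h0 : 0 < α) (h1 : α < 1) {i : ℕ} (hi : i < m)
    (hpos : 1 ≤ i → 1 / (m : ℝ) ≤ rankedMass p 0 ∧ tailMean p m i ≤ rankedMass p (i - 1)) :
    ∑ j, tildeMass p m j ^ α
      ≤ ∑ j ∈ Finset.range i, rankedMass p j ^ α + (m - i : ℝ) * tailMean p m i ^ α := by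
  have hm0 : (0 : ℝ) < m := by exact_mod_cast (by omega : 0 < m)
  rcases lt_or_ge (rankedMass p 0) (1 / (m : ℝ)) with h | h
  · have hi0 : i = 0 := by
      by_contra hne
      linarith [(hpos (by omega)).1]
    subst hi0
    rw [tailMean, sum_Ico_rankedMass hp1 (Nat.zero_le n)]
    simp only [tildeMass, if_pos h]
    simp
  · have hicut : i ≤ cutoff p m := by
      rcases Nat.eq_zero_or_pos i with rfl | hi0
      · exact Nat.zero_le _
      · exact Nat.le_findGreatest (by omega) (hpos hi0).2
    have hs : ∑ j, tildeMass p m j ^ α = ∑ j ∈ Finset.range m, tildeSeq p m j ^ α := by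
      rw [Finset.sum_range]
      simp only [tildeMass_eq_tildeSeq h]
    have hc := cutoff_lt (p := p) hm
    rw [hs, ← Finset.sum_range_add_sum_Ico _ hi.le]
    refine add_le_add (le_of_eq ?_) ?_
    · refine Finset.sum_congr rfl fun j hj => ?_
      have : j < cutoff p m := by simp at hj; omega
      simp [tildeSeq, this]
    · have := sum_rpow_le_of_avg (Finset.Ico i m) (by simpa using hi) h0.le h1.le
        (x := tildeSeq p m) (fun j _ => by
          unfold tildeSeq
          split_ifs
          · exact rankedMass_nonneg hp j
          · exact tailMean_nonneg hp hc)
      rw [sum_tildeSeq_Ico hm hmn hicut, Nat.card_Ico, Nat.cast_sub hi.le] at this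
      rwa [tailMean, one_div, ← div_eq_inv_mul]

theorem huffmanRatio_mul_le_sum_rpow_fiberMass (hm : 2 ≤ m) (hmn : m < n) (hp : ∀ x, 0 ≤ p x)
    (hp1 : ∑ x, p x = 1) {f : Fin n → Fin m} (hf : IsHuffmanMap p f) {α : ℝ} (h0 : 0 < α)
    (h1 : α < 1) :
    huffmanRatio α * ∑ i, tildeMass p m i ^ α ≤ ∑ j, fiberMass p f j ^ α := by
  classical
  obtain ⟨w, hw, hmerged, hge⟩ := hf.exists_threshold hp
  set q := fiberMass p f with hqdef
  have hq1 : ∑ j, q j = 1 := sum_fiberMass.trans hp1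
  have hsurj : ∀ j, w < q j → ∃ x, f x = j := fun j hj => by
    by_contra! hno
    have : q j = 0 := by
      simp only [hqdef, fiberMass]
      rw [Finset.filter_false_of_mem fun x _ => hno x, Finset.sum_empty]
    linarith
  have hsingle : ∀ x, w < q (f x) → q (f x) = p x := fun x hx => by
    simp only [hqdef, fiberMass]
    rw [Finset.sum_eq_single_of_mem x (by simp)]
    intro y hy hyx
    exact absurd (hmerged x y (Ne.symm hyx) (by simp only [Finset.mem_filter] at hy; exact hy.2.symm)) (not_le.2 hx)
  -- The map `f` restricts to a mass-preserving bijection from the symbols heavier than `w` to the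
  -- blocks heavier than `w`.
  have hbig : ∀ F : ℝ → ℝ, ∑ x with w < p x, F (p x) = ∑ j with w < q j, F (q j) := fun F => by
    refine Finset.sum_bij (fun x _ => f x) (fun x hx => ?_) (fun x hx y _ hxy => ?_)
      (fun j hj => ?_) (fun x hx => ?_)
    · simp only [Finset.mem_filter, Finset.mem_univ, true_and] at hx ⊢
      exact hx.trans_le (le_fiberMass hp x)
    · simp only [Finset.mem_filter, Finset.mem_univ, true_and] at hx
      by_contra hne
      exact absurd (hmerged x y hne hxy) (not_le.2 (hx.trans_le (le_fiberMass hp x)))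
    · simp only [Finset.mem_filter, Finset.mem_univ, true_and] at hj
      obtain ⟨x, rfl⟩ := hsurj j hj
      exact ⟨x, by simpa [← hsingle x hj] using hj, rfl⟩
    · simp only [Finset.mem_filter, Finset.mem_univ, true_and] at hx
      rw [hsingle x (hx.trans_le (le_fiberMass hp x))]
  set i := (Finset.univ.filter fun x => w < p x).card with hidef
  set S := Finset.univ.filter fun j => ¬ w < q j with hS
  have hcard : (S.card : ℝ) = m - i := by
    have e1 := hbig fun _ => (1 : ℝ)
    simp only [Finset.sum_const, nsmul_eq_mul, mul_one] at e1
    have e2 := Finset.card_filter_add_card_filter_not (s := (Finset.univ : Finset (Fin m))) (fun j => w < q j)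
    rw [hidef, e1, hS]
    rw [Finset.card_univ, Fintype.card_fin] at e2
    have e3 := congrArg (Nat.cast (R := ℝ)) e2
    push_cast at e3
    linarith
  -- By pigeonhole some fibre has two elements, and merged blocks have mass at most `w`.
  have hSne : S.Nonempty := by
    obtain ⟨x, y, hxy, hfxy⟩ := Fintype.exists_ne_map_eq_of_card_lt f (by simpa using hmn)
    exact ⟨f x, by simpa [hS] using hmerged x y hxy hfxy⟩
  have hSpos : (0 : ℝ) < S.card := by exact_mod_cast hSne.card_pos
  have hi : i < m := by
    have : (i : ℝ) < m := by linarith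
    exact_mod_cast this
  have hSle : ∀ j ∈ S, q j ≤ w := fun j hj => by simpa [hS] using hj
  have htail : tailMean p m i = (∑ j ∈ S, q j) / S.card := by
    rw [tailMean, sum_Ico_rankedMass hp1 (by omega), hcard, one_div, ← div_eq_inv_mul]
    congr 1
    have e1 := sum_filter_gt_eq_sum_rankedMass hp w (fun y => y)
    rw [← hidef] at e1
    rw [← e1, hbig fun y => y, ← hq1,
      ← Finset.sum_filter_add_sum_filter_not Finset.univ (fun j => w < q j)]
    ring
  have htw : tailMean p m i ≤ w := by
    rw [htail, div_le_iff₀ hSpos]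
    calc ∑ j ∈ S, q j ≤ ∑ j ∈ S, w := Finset.sum_le_sum hSle
      _ = _ := by rw [Finset.sum_const, nsmul_eq_mul]; ring
  have hpos : 1 ≤ i → 1 / (m : ℝ) ≤ rankedMass p 0 ∧ tailMean p m i ≤ rankedMass p (i - 1) := by
    intro hi1
    have hwr : w < rankedMass p (i - 1) := by
      have : i - 1 ∈ (Finset.range n).filter (fun i => w < rankedMass p i) := by
        rw [filter_rankedMass_gt hp, Finset.mem_range]
        omega
      exact (Finset.mem_filter.1 this).2
    refine ⟨?_, htw.trans hwr.le⟩
    have hr0 : rankedMass p (i - 1) ≤ rankedMass p 0 := rankedMass_antitone hp (Nat.zero_le _)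
    -- Heavy blocks are single symbols and light ones are at most `w < p_i ≤ p₁`, so every block is
    -- at most `p₁`; summing `m` of them gives `1 ≤ m * p₁`.
    have hqle : ∀ j, q j ≤ rankedMass p 0 := fun j => by
      rcases lt_or_ge w (q j) with hj | hj
      · obtain ⟨x, rfl⟩ := hsurj j hj
        rw [hsingle x hj]
        have := sum_le_sum_rankedMass hp {x}
        simpa using this
      · linarith
    have : (1 : ℝ) ≤ m * rankedMass p 0 := by
      rw [← hq1]
      calc ∑ j, q j ≤ ∑ _j : Fin m, rankedMass p 0 := Finset.sum_le_sum fun j _ => hqle j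
        _ = _ := by simp
    rw [div_le_iff₀ (by exact_mod_cast (by omega : 0 < m))]
    linarith
  have hK := huffmanRatio_pos h0 h1
  have hpre : 0 ≤ ∑ j ∈ Finset.range i, rankedMass p j ^ α :=
    Finset.sum_nonneg fun j _ => Real.rpow_nonneg (rankedMass_nonneg hp j) _
  calc huffmanRatio α * ∑ j, tildeMass p m j ^ α
      ≤ huffmanRatio α * (∑ j ∈ Finset.range i, rankedMass p j ^ α
          + (m - i : ℝ) * tailMean p m i ^ α) := by
        gcongr
        exact sum_tildeMass_rpow_le hm hmn hp hp1 h0 h1 hi hpos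
    _ ≤ ∑ j ∈ Finset.range i, rankedMass p j ^ α
          + huffmanRatio α * (S.card * ((∑ j ∈ S, q j) / S.card) ^ α) := by
        rw [mul_add, hcard, ← hcard, ← htail]
        gcongr
        exact mul_le_of_le_one_left hpre (huffmanRatio_le_one h0 h1)
    _ ≤ ∑ j with w < q j, q j ^ α + ∑ j ∈ S, q j ^ α := by
        refine add_le_add (le_of_eq ?_) ?_
        · rw [← hbig fun y => y ^ α, sum_filter_gt_eq_sum_rankedMass hp w fun y => y ^ α]
        · exact huffmanRatio_mul_le_sum_rpow h0 h1 S hw (fun j _ => hge j) hSle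
    _ = _ := Finset.sum_filter_add_sum_filter_not _ _ _

end Huffman

/-! ### Arikan's bounds on guessing moments. -/

section Ranking

variable {A : Type*} [Fintype A] {g : A → ℕ}

lemma sum_inv_le_one_add_log (hg : Set.BijOn g Set.univ (Set.Icc 1 (Fintype.card A))) :
    ∑ a, ((g a : ℝ))⁻¹ ≤ 1 + Real.log (Fintype.card A) := by
  have h := harmonic_le_one_add_log (Fintype.card A)
  rw [harmonic_eq_sum_Icc] at h
  push_cast at h
  refine le_trans (le_of_eq ?_) h
  refine Finset.sum_bij (fun a _ => g a) (fun a _ => ?_) (fun a _ c _ hac => ?_) (fun i hi => ?_)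
    (fun a _ => rfl)
  · simpa using hg.mapsTo (Set.mem_univ a)
  · exact hg.injOn (Set.mem_univ a) (Set.mem_univ c) hac
  · obtain ⟨a, -, ha⟩ := hg.surjOn (show i ∈ Set.Icc 1 (Fintype.card A) by simpa using hi)
    exact ⟨a, Finset.mem_univ a, ha⟩

lemma one_le_of_bijOn (hg : Set.BijOn g Set.univ (Set.Icc 1 (Fintype.card A))) (a : A) : 1 ≤ g a :=
  (hg.mapsTo (Set.mem_univ a)).1

/-- Arikan's lower bound on the guessing moments. -/
lemma rpow_sum_le_guessing_moment (hg : Set.BijOn g Set.univ (Set.Icc 1 (Fintype.card A)))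
    {P : A → ℝ} (hP : ∀ a, 0 ≤ P a) {ρ : ℝ} (hρ : 0 < ρ) :
    (∑ a, P a ^ (1 / (1 + ρ))) ^ (1 + ρ)
      ≤ (1 + Real.log (Fintype.card A)) ^ ρ * ∑ a, P a * (g a : ℝ) ^ ρ := by
  have hg1 : ∀ a, (1 : ℝ) ≤ g a := fun a => by exact_mod_cast one_le_of_bijOn hg a
  have hg0 : ∀ a, (0 : ℝ) < g a := fun a => by linarith [hg1 a]
  have h1ρ : 0 < 1 + ρ := by linarith
  have hconj : (1 + ρ).HolderConjugate ((1 + ρ) / ρ) := by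
    rw [Real.holderConjugate_iff]
    exact ⟨by linarith, by field_simp⟩
  -- Hölder for the splitting of `P ^ α` into `P ^ α * g ^ (ρ / (1 + ρ))` and `g ^ (-(ρ / (1 +
  -- ρ)))`. The second factor yields the harmonic sum, and only bijectivity of `g` is needed.
  have h := Real.inner_le_Lp_mul_Lq_of_nonneg Finset.univ hconj
    (f := fun a => P a ^ (1 / (1 + ρ)) * (g a : ℝ) ^ (ρ / (1 + ρ)))
    (g := fun a => (g a : ℝ) ^ (-(ρ / (1 + ρ))))
    (fun a _ => mul_nonneg (Real.rpow_nonneg (hP a) _) (Real.rpow_nonneg (hg0 a).le _))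
    (fun a _ => Real.rpow_nonneg (hg0 a).le _)
  have e1 : ∀ a, P a ^ (1 / (1 + ρ)) * (g a : ℝ) ^ (ρ / (1 + ρ)) * (g a : ℝ) ^ (-(ρ / (1 + ρ)))
      = P a ^ (1 / (1 + ρ)) := fun a => by
    rw [mul_assoc, ← Real.rpow_add (hg0 a), add_neg_cancel, Real.rpow_zero, mul_one]
  have e2 : ∀ a, (P a ^ (1 / (1 + ρ)) * (g a : ℝ) ^ (ρ / (1 + ρ))) ^ (1 + ρ)
      = P a * (g a : ℝ) ^ ρ := fun a => by
    rw [Real.mul_rpow (Real.rpow_nonneg (hP a) _) (Real.rpow_nonneg (hg0 a).le _),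
      ← Real.rpow_mul (hP a), ← Real.rpow_mul (hg0 a).le, div_mul_cancel₀ _ h1ρ.ne',
      div_mul_cancel₀ _ h1ρ.ne', Real.rpow_one]
  have e3 : ∀ a, ((g a : ℝ) ^ (-(ρ / (1 + ρ)))) ^ ((1 + ρ) / ρ) = ((g a : ℝ))⁻¹ := fun a => by
    rw [← Real.rpow_mul (hg0 a).le, show -(ρ / (1 + ρ)) * ((1 + ρ) / ρ) = -1 by field_simp,
      Real.rpow_neg_one]
  simp only [e1, e2, e3] at h
  have hM : 0 ≤ ∑ a, P a * (g a : ℝ) ^ ρ :=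
    Finset.sum_nonneg fun a _ => mul_nonneg (hP a) (Real.rpow_nonneg (hg0 a).le _)
  have hI : 0 ≤ ∑ a, ((g a : ℝ))⁻¹ := Finset.sum_nonneg fun a _ => (inv_pos.2 (hg0 a)).le
  calc (∑ a, P a ^ (1 / (1 + ρ))) ^ (1 + ρ)
      ≤ ((∑ a, P a * (g a : ℝ) ^ ρ) ^ (1 / (1 + ρ))
          * (∑ a, ((g a : ℝ))⁻¹) ^ (1 / ((1 + ρ) / ρ))) ^ (1 + ρ) :=
        Real.rpow_le_rpow (Finset.sum_nonneg fun a _ => Real.rpow_nonneg (hP a) _) h h1ρ.le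
    _ = (∑ a, P a * (g a : ℝ) ^ ρ) * (∑ a, ((g a : ℝ))⁻¹) ^ ρ := by
        rw [Real.mul_rpow (Real.rpow_nonneg hM _) (Real.rpow_nonneg hI _), ← Real.rpow_mul hM,
          ← Real.rpow_mul hI, div_mul_cancel₀ _ h1ρ.ne', Real.rpow_one, one_div_div,
          div_mul_cancel₀ _ h1ρ.ne']
    _ ≤ (∑ a, P a * (g a : ℝ) ^ ρ) * (1 + Real.log (Fintype.card A)) ^ ρ :=
        mul_le_mul_of_nonneg_left
          (Real.rpow_le_rpow hI (sum_inv_le_one_add_log hg) hρ.le) hM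
    _ = _ := mul_comm _ _

/-- Exactly `g a` symbols have rank at most `g a`, and each is at least as probable as `a`. -/
lemma rank_mul_rpow_le_sum (hg : Set.BijOn g Set.univ (Set.Icc 1 (Fintype.card A)))
    {P : A → ℝ} (hP : ∀ a, 0 ≤ P a) (hmono : ∀ x y, P y < P x → g x < g y) {α : ℝ} (hα : 0 ≤ α)
    (a : A) : (g a : ℝ) * P a ^ α ≤ ∑ c, P c ^ α := by
  classical
  have hsub : ((Finset.univ.filter fun c => g c ≤ g a).card : ℝ) = g a := by
    have : (Finset.univ.filter fun c => g c ≤ g a).card = (Finset.Icc 1 (g a)).card := by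
      refine Finset.card_bij (fun c _ => g c) (fun c hc => ?_) (fun c _ d _ hcd => ?_)
        (fun i hi => ?_)
      · simpa [one_le_of_bijOn hg c] using hc
      · exact hg.injOn (Set.mem_univ c) (Set.mem_univ d) hcd
      · rw [Finset.mem_Icc] at hi
        obtain ⟨c, -, hc⟩ := hg.surjOn
          (show i ∈ Set.Icc 1 (Fintype.card A) from
            ⟨hi.1, hi.2.trans (hg.mapsTo (Set.mem_univ a)).2⟩)
        exact ⟨c, by simp [hc, hi.2], hc⟩
    rw [this]; simp
  calc (g a : ℝ) * P a ^ α = ∑ c with g c ≤ g a, P a ^ α := by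
        rw [Finset.sum_const, nsmul_eq_mul, hsub]
    _ ≤ ∑ c with g c ≤ g a, P c ^ α := by
        refine Finset.sum_le_sum fun c hc => Real.rpow_le_rpow (hP a) ?_ hα
        by_contra! hlt
        exact absurd (hmono _ _ hlt) (not_lt.2 (by simpa using hc))
    _ ≤ _ := Finset.sum_le_sum_of_subset_of_nonneg (Finset.filter_subset _ _)
        fun c _ _ => Real.rpow_nonneg (hP c) _

/-- Arikan's upper bound on the guessing moments. -/
lemma guessing_moment_le_rpow_sum (hg : Set.BijOn g Set.univ (Set.Icc 1 (Fintype.card A)))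
    {P : A → ℝ} (hP : ∀ a, 0 ≤ P a) (hmono : ∀ x y, P y < P x → g x < g y) {ρ : ℝ} (hρ : 0 < ρ) :
    ∑ a, P a * (g a : ℝ) ^ ρ ≤ (∑ a, P a ^ (1 / (1 + ρ))) ^ (1 + ρ) := by
  have h1ρ : 0 < 1 + ρ := by linarith
  have hα : 0 ≤ 1 / (1 + ρ) := by positivity
  have hS : 0 ≤ ∑ a, P a ^ (1 / (1 + ρ)) :=
    Finset.sum_nonneg fun a _ => Real.rpow_nonneg (hP a) _
  have hterm : ∀ a, P a * (g a : ℝ) ^ ρ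
      ≤ P a ^ (1 / (1 + ρ)) * (∑ a, P a ^ (1 / (1 + ρ))) ^ ρ := fun a => by
    -- Since `α * (1 + ρ) = 1`, one factor `P ^ α` stays and the other `ρ` of them absorb the rank.
    have hpa : P a = P a ^ (1 / (1 + ρ)) * (P a ^ (1 / (1 + ρ))) ^ ρ := by
      rcases (hP a).eq_or_lt with h | h
      · rw [← h, Real.zero_rpow (by positivity), zero_mul]
      · rw [← Real.rpow_mul h.le, ← Real.rpow_add h,
          show 1 / (1 + ρ) + 1 / (1 + ρ) * ρ = 1 by field_simp, Real.rpow_one]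
    have h := Real.rpow_le_rpow
      (mul_nonneg (Nat.cast_nonneg _) (Real.rpow_nonneg (hP a) _))
      (rank_mul_rpow_le_sum hg hP hmono hα a) hρ.le
    rw [Real.mul_rpow (Nat.cast_nonneg _) (Real.rpow_nonneg (hP a) _)] at h
    calc P a * (g a : ℝ) ^ ρ
        = P a ^ (1 / (1 + ρ)) * ((g a : ℝ) ^ ρ * (P a ^ (1 / (1 + ρ))) ^ ρ) := by
          conv_lhs => rw [hpa]
          ring
      _ ≤ _ := mul_le_mul_of_nonneg_left h (Real.rpow_nonneg (hP a) _)
  calc ∑ a, P a * (g a : ℝ) ^ ρ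
      ≤ ∑ a, P a ^ (1 / (1 + ρ)) * (∑ a, P a ^ (1 / (1 + ρ))) ^ ρ :=
        Finset.sum_le_sum fun a _ => hterm a
    _ = _ := by
        rw [← Finset.sum_mul, Real.rpow_add' hS h1ρ.ne', Real.rpow_one]

end Ranking

/-! ### Guessing moments of i.i.d. vectors in terms of Rényi entropy. -/

section Sample

variable {Ω : Type*} [MeasurableSpace Ω] {μ : Measure Ω} {n m k : ℕ} {p : Fin n → ℝ}
  {X : Fin k → Ω → Fin n}

lemma IsIIDSample.measurable_vector (hX : IsIIDSample μ p X) : Measurable fun ω i => X i ω :=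
  measurable_pi_iff.2 hX.measurable

lemma IsIIDSample.vector_law (hX : IsIIDSample μ p X) (x : Fin k → Fin n) :
    μ.real ((fun ω i => X i ω) ⁻¹' {x}) = ∏ i, p (x i) := by
  have e : (fun ω i => X i ω) ⁻¹' {x} = ⋂ i ∈ (Finset.univ : Finset (Fin k)), X i ⁻¹' {x i} := by
    ext ω
    simp [funext_iff]
  rw [e, measureReal_def, hX.indep.measure_inter_preimage_eq_mul Finset.univ
    (fun i _ => measurableSet_singleton _), ENNReal.toReal_prod]
  exact Finset.prod_congr rfl fun i _ => hX.law i (x i)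

lemma IsIIDSample.comp [IsProbabilityMeasure μ] (hX : IsIIDSample μ p X) (f : Fin n → Fin m) :
    IsIIDSample μ (fiberMass p f) fun i ω => f (X i ω) where
  measurable i := (measurable_of_finite f).comp (hX.measurable i)
  indep := hX.indep.comp (fun _ => f) fun _ => measurable_of_finite f
  law i j := by
    have h := sum_measureReal_preimage_singleton (μ := μ) (f := X i)
      (Finset.univ.filter fun x => f x = j)
      (fun x _ => hX.measurable i (measurableSet_singleton x))
    simp only [hX.law] at h
    rw [fiberMass, h]
    congr 1
    ext ω
    simp

lemma integral_comp_eq_sum [IsFiniteMeasure μ] {A : Type*} [Fintype A] [MeasurableSpace A]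
    [MeasurableSingletonClass A] {Z : Ω → A} (hZ : Measurable Z) (F : A → ℝ) :
    ∫ ω, F (Z ω) ∂μ = ∑ a, μ.real (Z ⁻¹' {a}) * F a := by
  rw [← integral_map hZ.aemeasurable (measurable_of_finite F).aestronglyMeasurable,
    integral_fintype (Integrable.of_finite)]
  refine Finset.sum_congr rfl fun a _ => ?_
  rw [map_measureReal_apply hZ (measurableSet_singleton a), smul_eq_mul]

lemma sum_prod_rpow (hp : ∀ x, 0 ≤ p x) (k : ℕ) (α : ℝ) :
    ∑ x : Fin k → Fin n, (∏ i, p (x i)) ^ α = (∑ x, p x ^ α) ^ k := by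
  simp only [← Real.finsetProd_rpow _ _ (fun i _ => hp _)]
  rw [← Fintype.piFinset_univ, ← Finset.prod_univ_sum (fun _ => Finset.univ) (fun _ x => p x ^ α)]
  simp

lemma IsIIDSample.moment_bounds [IsProbabilityMeasure μ] (hp : ∀ x, 0 ≤ p x)
    (hX : IsIIDSample μ p X) {g : (Fin k → Fin n) → ℕ}
    (hg : IsRankingFunction μ (fun ω i => X i ω) g) {ρ : ℝ} (hρ : 0 < ρ) :
    ((∑ x, p x ^ (1 / (1 + ρ))) ^ k) ^ (1 + ρ)
        ≤ (1 + k * Real.log n) ^ ρ * ∫ ω, (g (fun i => X i ω) : ℝ) ^ ρ ∂μ ∧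
      ∫ ω, (g (fun i => X i ω) : ℝ) ^ ρ ∂μ ≤ ((∑ x, p x ^ (1 / (1 + ρ))) ^ k) ^ (1 + ρ) := by
  have hP : ∀ x : Fin k → Fin n, 0 ≤ ∏ i, p (x i) := fun x => Finset.prod_nonneg fun i _ => hp _
  have hint := integral_comp_eq_sum (μ := μ) hX.measurable_vector (fun x => (g x : ℝ) ^ ρ)
  simp only [hX.vector_law] at hint
  rw [hint, ← sum_prod_rpow hp]
  refine ⟨?_, guessing_moment_le_rpow_sum hg.bijOn hP (fun x y hxy => ?_) hρ⟩
  · have := rpow_sum_le_guessing_moment hg.bijOn hP hρ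
    simpa using this
  · exact hg.lt_of_prob_lt x y (by rwa [hX.vector_law, hX.vector_law])

lemma sum_rpow_pos (hp : ∀ x, 0 ≤ p x) (hp1 : ∑ x, p x = 1) (α : ℝ) : 0 < ∑ x, p x ^ α := by
  obtain ⟨x, -, hx⟩ := Finset.exists_ne_zero_of_sum_ne_zero (hp1.trans_ne one_ne_zero)
  exact Finset.sum_pos' (fun y _ => Real.rpow_nonneg (hp y) _)
    ⟨x, Finset.mem_univ x, Real.rpow_pos_of_pos ((hp x).lt_of_ne' hx) _⟩

lemma mul_renyiEntropy {A : Type*} [Fintype A] (b : ℝ) (P : A → ℝ) {ρ : ℝ} (hρ : 0 < ρ) :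
    ρ * renyiEntropy b (1 / (1 + ρ)) P
      = (1 + ρ) * Real.logb b (∑ x, P x ^ (1 / (1 + ρ))) := by
  have h1ρ : 1 + ρ ≠ 0 := by positivity
  have hne : 1 / (1 + ρ) ≠ 1 := by
    rw [Ne, div_eq_one_iff_eq h1ρ]; linarith
  rw [renyiEntropy, if_neg hne, show 1 - 1 / (1 + ρ) = ρ / (1 + ρ) by field_simp; ring]
  field_simp

lemma IsIIDSample.logb_moment_bounds [IsProbabilityMeasure μ] {b : ℝ} (hb : 1 < b) (hn : 1 ≤ n)
    (hk : 1 ≤ k) (hp : ∀ x, 0 ≤ p x) (hp1 : ∑ x, p x = 1)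
    (hX : IsIIDSample μ p X) {g : (Fin k → Fin n) → ℕ}
    (hg : IsRankingFunction μ (fun ω i => X i ω) g) {ρ : ℝ} (hρ : 0 < ρ) :
    0 < ∫ ω, (g (fun i => X i ω) : ℝ) ^ ρ ∂μ ∧
    ρ * renyiEntropy b (1 / (1 + ρ)) p - ρ * Real.logb b (1 + k * Real.log n) / k
      ≤ 1 / k * Real.logb b (∫ ω, (g (fun i => X i ω) : ℝ) ^ ρ ∂μ) ∧
    1 / k * Real.logb b (∫ ω, (g (fun i => X i ω) : ℝ) ^ ρ ∂μ)
      ≤ ρ * renyiEntropy b (1 / (1 + ρ)) p := by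
  obtain ⟨hlo, hup⟩ := hX.moment_bounds hp hg hρ
  have hS := sum_rpow_pos hp hp1 (1 / (1 + ρ))
  have hk0 : (0 : ℝ) < k := by exact_mod_cast hk
  have hL : 0 < 1 + k * Real.log n := by
    have := Real.log_nonneg (show (1 : ℝ) ≤ n by exact_mod_cast hn)
    positivity
  have hSk : 0 < ((∑ x, p x ^ (1 / (1 + ρ))) ^ k) ^ (1 + ρ) := by positivity
  have hE : 0 < ∫ ω, (g (fun i => X i ω) : ℝ) ^ ρ ∂μ :=
    pos_of_mul_pos_right (hSk.trans_le hlo) (Real.rpow_nonneg hL.le _)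
  have hlog : Real.logb b (((∑ x, p x ^ (1 / (1 + ρ))) ^ k) ^ (1 + ρ))
      = k * (ρ * renyiEntropy b (1 / (1 + ρ)) p) := by
    rw [mul_renyiEntropy b p hρ, Real.logb_rpow_eq_mul_logb_of_pos (by positivity),
      Real.logb_pow]
    ring
  refine ⟨hE, ?_, ?_⟩
  · have h := Real.logb_le_logb_of_le hb hSk hlo
    rw [hlog, Real.logb_mul (by positivity) hE.ne', Real.logb_rpow_eq_mul_logb_of_pos hL] at h
    rw [sub_le_iff_le_add, one_div (k : ℝ), ← div_eq_inv_mul, ← add_div, le_div_iff₀ hk0]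
    linarith
  · have h := Real.logb_le_logb_of_le hb hE hup
    rw [hlog] at h
    rw [one_div, inv_mul_le_iff₀ hk0]
    exact h

end Sample

/-! ### The two bounds and their asymptotic gap. -/

section Bounds

variable {Ω : Type*} [MeasurableSpace Ω] {μ : Measure Ω} {n m k : ℕ}
  {p : Fin n → ℝ} {X : Fin k → Ω → Fin n} {b ρ : ℝ} {f : Fin n → Fin m}
  {g : (Fin k → Fin n) → ℕ} {h : (Fin k → Fin m) → ℕ}

lemma order_mem_Ioo (hρ : 0 < ρ) : 0 < 1 / (1 + ρ) ∧ 1 / (1 + ρ) < 1 :=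
  ⟨by positivity, by rw [div_lt_one (by linarith)]; linarith⟩

lemma guessingReduction_eq
    (hg : 0 < ∫ ω, (g (fun i => X i ω) : ℝ) ^ ρ ∂μ)
    (hh : 0 < ∫ ω, (h (fun i => f (X i ω)) : ℝ) ^ ρ ∂μ) :
    guessingReduction μ b ρ X f g h
      = 1 / k * Real.logb b (∫ ω, (g (fun i => X i ω) : ℝ) ^ ρ ∂μ)
        - 1 / k * Real.logb b (∫ ω, (h (fun i => f (X i ω)) : ℝ) ^ ρ ∂μ) := by
  rw [guessingReduction, Real.logb_div hg.ne' hh.ne', mul_sub]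

theorem lowerBound_le_guessingReduction [IsProbabilityMeasure μ] (hb : 1 < b) (hm : 2 ≤ m) (hmn : m < n)
    (hp : ∀ x, 0 ≤ p x) (hp1 : ∑ x, p x = 1) (hρ : 0 < ρ) (hk : 1 ≤ k) (hX : IsIIDSample μ p X)
    (hg : IsRankingFunction μ (fun ω i => X i ω) g)
    (hh : IsRankingFunction μ (fun ω i => f (X i ω)) h) :
    lowerBound b p m ρ k ≤ guessingReduction μ b ρ X f g h := by
  have hq := fiberMass_nonneg (f := f) hp
  have hq1 : ∑ j, fiberMass p f j = 1 := sum_fiberMass.trans hp1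
  obtain ⟨hα0, hα1⟩ := order_mem_Ioo hρ
  obtain ⟨gpos, glo, -⟩ := hX.logb_moment_bounds hb (by omega) hk hp hp1 hg hρ
  obtain ⟨hpos, -, hup⟩ := (hX.comp f).logb_moment_bounds hb (by omega) hk hq hq1 hh hρ
  have hH : ρ * renyiEntropy b (1 / (1 + ρ)) (fiberMass p f)
      ≤ ρ * renyiEntropy b (1 / (1 + ρ)) (tildeMass p m) := by
    rw [mul_renyiEntropy b _ hρ, mul_renyiEntropy b _ hρ]
    exact mul_le_mul_of_nonneg_left (Real.logb_le_logb_of_le hb (sum_rpow_pos hq hq1 _)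
      (sum_rpow_fiberMass_le hm hmn hp hp1 f hα0 hα1)) (by linarith)
  rw [guessingReduction_eq gpos hpos, lowerBound, mul_sub]
  linarith

theorem guessingReduction_le_upperBound [IsProbabilityMeasure μ] (hb : 1 < b) (hm : 2 ≤ m) (hmn : m < n)
    (hp : ∀ x, 0 ≤ p x) (hp1 : ∑ x, p x = 1) (hf : IsHuffmanMap p f) (hρ : 0 < ρ) (hk : 1 ≤ k)
    (hX : IsIIDSample μ p X) (hg : IsRankingFunction μ (fun ω i => X i ω) g)
    (hh : IsRankingFunction μ (fun ω i => f (X i ω)) h) :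
    guessingReduction μ b ρ X f g h ≤ upperBound b p m ρ k := by
  have hq := fiberMass_nonneg (f := f) hp
  have hq1 : ∑ j, fiberMass p f j = 1 := sum_fiberMass.trans hp1
  obtain ⟨hα0, hα1⟩ := order_mem_Ioo hρ
  obtain ⟨gpos, -, gup⟩ := hX.logb_moment_bounds hb (by omega) hk hp hp1 hg hρ
  obtain ⟨hpos, hlo, -⟩ := (hX.comp f).logb_moment_bounds hb (by omega) hk hq hq1 hh hρ
  have hK := huffmanRatio_pos hα0 hα1
  have ht := (sum_rpow_pos hq hq1 (1 / (1 + ρ))).trans_le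
    (sum_rpow_fiberMass_le hm hmn hp hp1 f hα0 hα1)
  have hH : ρ * renyiEntropy b (1 / (1 + ρ)) (tildeMass p m) - ρ * v b (1 / (1 + ρ))
      ≤ ρ * renyiEntropy b (1 / (1 + ρ)) (fiberMass p f) := by
    have e := Real.logb_le_logb_of_le hb (mul_pos hK ht)
      (huffmanRatio_mul_le_sum_rpow_fiberMass hm hmn hp hp1 hf hα0 hα1)
    rw [Real.logb_mul hK.ne' ht.ne', logb_huffmanRatio b hα0 hα1] at e
    have e' := mul_le_mul_of_nonneg_left e (show 0 ≤ 1 + ρ by linarith)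
    have e3 : (1 + ρ) * (1 - 1 / (1 + ρ)) = ρ := by
      have : 1 + ρ ≠ 0 := by linarith
      field_simp; ring
    have e4 : (1 + ρ) * -((1 - 1 / (1 + ρ)) * v b (1 / (1 + ρ))) = -(ρ * v b (1 / (1 + ρ))) := by
      linear_combination (-(v b (1 / (1 + ρ)))) * e3
    rw [mul_renyiEntropy b _ hρ, mul_renyiEntropy b _ hρ]
    rw [mul_add, e4] at e'
    linarith
  rw [guessingReduction_eq gpos hpos, upperBound, mul_add, mul_sub]
  linarith

theorem tendsto_upperBound_sub_lowerBound (b : ℝ) (p : Fin n → ℝ) (m : ℕ) (ρ : ℝ) :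
    Tendsto (fun k : ℕ => upperBound b p m ρ k - lowerBound b p m ρ k) atTop
      (𝓝 (ρ * v b (1 / (1 + ρ)))) := by
  have hlim : ∀ N : ℕ, Tendsto (fun k : ℕ => ρ * Real.logb b (1 + k * Real.log N) / k) atTop
      (𝓝 0) := fun N => by
    have hL : 0 ≤ Real.log N := Real.log_natCast_nonneg N
    have hlog : Tendsto (fun k : ℕ => Real.log (1 + k * Real.log N) / k) atTop (𝓝 0) := by
      -- If `log N = 0` the argument of the logarithm stays bounded. Otherwise, with `x = 1 + k *
      -- log N`, the quotient is `(log x / x) * (x / k)`.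
      rcases hL.eq_or_lt with h0 | h0
      · simp [← h0]
      · have hx : Tendsto (fun k : ℕ => 1 + (k : ℝ) * Real.log N) atTop atTop :=
          tendsto_atTop_add_const_left _ _ (tendsto_natCast_atTop_atTop.atTop_mul_const h0)
        have h1 := (Real.isLittleO_log_id_atTop.comp_tendsto hx).tendsto_div_nhds_zero
        have h2 : Tendsto (fun k : ℕ => (1 + (k : ℝ) * Real.log N) / k) atTop
            (𝓝 (Real.log N)) := by
          have h3 : Tendsto (fun k : ℕ => 1 / (k : ℝ) + Real.log N) atTop (𝓝 (0 + Real.log N)) :=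
            tendsto_one_div_atTop_nhds_zero_nat.add_const _
          rw [zero_add] at h3
          refine h3.congr' ?_
          filter_upwards [eventually_ge_atTop 1] with k hk
          have : (k : ℝ) ≠ 0 := by positivity
          field_simp
        have h4 := h1.mul h2
        rw [zero_mul] at h4
        refine h4.congr' ?_
        filter_upwards with k
        have : 0 < 1 + (k : ℝ) * Real.log N := by positivity
        simp only [Function.comp_apply, id]
        field_simp
    have := hlog.const_mul (ρ / Real.log b)
    rw [mul_zero] at this
    refine this.congr fun k => ?_
    rw [Real.logb]; ring
  have h := ((hlim m).add (hlim n)).const_add (ρ * v b (1 / (1 + ρ)))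
  rw [add_zero, add_zero] at h
  refine h.congr fun k => ?_
  rw [upperBound, lowerBound]; ring

end Bounds

/-! ### Numerical value of the gap in bits. -/

section Numerics

lemma nonneg_of_deriv_nonneg {f f' : ℝ → ℝ} {L : ℝ} (hf : ∀ x, HasDerivAt f (f' x) x)
    (h0 : f 0 = 0) (hf' : ∀ x, 0 ≤ x → x ≤ L → 0 ≤ f' x) {t : ℝ} (ht0 : 0 ≤ t) (htL : t ≤ L) :
    0 ≤ f t := by
  have hmono : MonotoneOn f (Set.Icc 0 L) :=
    monotoneOn_of_deriv_nonneg (convex_Icc 0 L) (fun x _ => (hf x).continuousAt.continuousWithinAt)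
      (fun x _ => (hf x).differentiableAt.differentiableWithinAt) fun x hx => by
        rw [interior_Icc] at hx
        rw [(hf x).deriv]
        exact hf' x hx.1.le hx.2.le
  rw [← h0]
  exact hmono ⟨le_rfl, ht0.trans htL⟩ ⟨ht0, htL⟩ ht0

lemma sinh_le_mul_cosh {t : ℝ} (ht : 0 ≤ t) : 0 ≤ t * Real.cosh t - Real.sinh t := by
  refine nonneg_of_deriv_nonneg (f := fun t => t * Real.cosh t - Real.sinh t)
    (f' := fun t => t * Real.sinh t) (L := t) (fun x => ?_) (by simp) (fun x hx _ => ?_) ht le_rfl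
  · exact (((hasDerivAt_id x).mul (Real.hasDerivAt_cosh x)).sub (Real.hasDerivAt_sinh x)).congr_deriv
      (by simp)
  · exact mul_nonneg hx (Real.sinh_nonneg_iff.2 hx)

lemma mul_cosh_sub_sinh_le {C L t : ℝ} (hC : ∀ x, 0 ≤ x → x ≤ L → Real.cosh x ≤ C) (ht0 : 0 ≤ t)
    (htL : t ≤ L) : 0 ≤ C * t ^ 3 / 3 - (t * Real.cosh t - Real.sinh t) := by
  refine nonneg_of_deriv_nonneg (f := fun t => C * t ^ 3 / 3 - (t * Real.cosh t - Real.sinh t))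
    (f' := fun t => C * t ^ 2 - t * Real.sinh t) (L := L) (fun x => ?_) (by simp)
    (fun x hx hxL => ?_) ht0 htL
  · exact ((((hasDerivAt_pow 3 x).const_mul C).div_const 3).sub
      (((hasDerivAt_id x).mul (Real.hasDerivAt_cosh x)).sub (Real.hasDerivAt_sinh x))).congr_deriv
      (by simp; ring)
  · have h1 := sinh_le_mul_cosh hx
    have h2 := mul_le_mul_of_nonneg_left (hC x hx hxL) hx
    nlinarith

lemma hasDerivAt_sq_mul_sinh (x : ℝ) :
    HasDerivAt (fun t => t ^ 2 * Real.sinh t / 3 - (t * Real.cosh t - Real.sinh t))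
      (x / 3 * (x * Real.cosh x - Real.sinh x)) x :=
  ((((hasDerivAt_pow 2 x).mul (Real.hasDerivAt_sinh x)).div_const 3).sub
    (((hasDerivAt_id x).mul (Real.hasDerivAt_cosh x)).sub (Real.hasDerivAt_sinh x))).congr_deriv
    (by simp; ring)

lemma mul_cosh_sub_sinh_le_sq_mul_sinh {t : ℝ} (ht : 0 ≤ t) :
    0 ≤ t ^ 2 * Real.sinh t / 3 - (t * Real.cosh t - Real.sinh t) :=
  nonneg_of_deriv_nonneg (L := t) hasDerivAt_sq_mul_sinh (by simp)
    (fun _ hx _ => mul_nonneg (by positivity) (sinh_le_mul_cosh hx)) ht le_rfl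

lemma sq_mul_sinh_sub_le {C L t : ℝ} (hC : ∀ x, 0 ≤ x → x ≤ L → Real.cosh x ≤ C) (ht0 : 0 ≤ t)
    (htL : t ≤ L) :
    0 ≤ C * t ^ 5 / 45 - (t ^ 2 * Real.sinh t / 3 - (t * Real.cosh t - Real.sinh t)) := by
  refine nonneg_of_deriv_nonneg
    (f := fun t => C * t ^ 5 / 45 - (t ^ 2 * Real.sinh t / 3 - (t * Real.cosh t - Real.sinh t)))
    (f' := fun x => C * x ^ 4 / 9 - x / 3 * (x * Real.cosh x - Real.sinh x))
    (L := L) (fun x => ?_) (by simp) (fun x hx hxL => ?_) ht0 htL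
  · exact ((((hasDerivAt_pow 5 x).const_mul C).div_const 45).sub
      (hasDerivAt_sq_mul_sinh x)).congr_deriv (by simp; ring)
  · have h1 := mul_nonneg (show 0 ≤ x / 3 by positivity) (mul_cosh_sub_sinh_le hC hx hxL)
    linarith

/-- `logSinhDefect t = t ^ 2 / 6 - log (sinh t / t)`. -/
noncomputable def logSinhDefect (t : ℝ) : ℝ := t ^ 2 / 6 - (Real.log (Real.sinh t) - Real.log t)

lemma hasDerivAt_logSinhDefect {t : ℝ} (ht : 0 < t) :
    HasDerivAt logSinhDefect
      ((t ^ 2 * Real.sinh t / 3 - (t * Real.cosh t - Real.sinh t)) / (t * Real.sinh t)) t := by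
  have hs : 0 < Real.sinh t := Real.sinh_pos_iff.2 ht
  refine (((hasDerivAt_pow 2 t).div_const 6).sub
    (((Real.hasDerivAt_sinh t).log hs.ne').sub (Real.hasDerivAt_log ht.ne'))).congr_deriv ?_
  simp only [Nat.cast_ofNat, Nat.add_one_sub_one, pow_one]
  field_simp
  ring

/-- The derivative of the defect is `t / 3 - coth t + 1 / t`, which lies between `0` and `C * t ^ 3
/ 45`. -/
lemma logSinhDefect_sub_bounds {C L s : ℝ} (hC : ∀ x, 0 ≤ x → x ≤ L → Real.cosh x ≤ C)
    (hs : 0 < s) (hsL : s ≤ L) :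
    0 ≤ logSinhDefect L - logSinhDefect s ∧
      logSinhDefect L - logSinhDefect s ≤ C * L ^ 3 / 45 * (L - s) := by
  have hcont : ContinuousOn logSinhDefect (Set.Icc s L) := fun x hx =>
    (hasDerivAt_logSinhDefect (hs.trans_le hx.1)).continuousAt.continuousWithinAt
  have hdiff : DifferentiableOn ℝ logSinhDefect (interior (Set.Icc s L)) := fun x hx => by
    rw [interior_Icc] at hx
    exact (hasDerivAt_logSinhDefect (hs.trans hx.1)).differentiableAt.differentiableWithinAt
  have hC0 : 0 ≤ C := (Real.cosh_pos s).le.trans (hC s hs.le hsL)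
  constructor
  · have := monotoneOn_of_deriv_nonneg (convex_Icc s L) hcont hdiff fun x hx => by
      rw [interior_Icc] at hx
      have hx0 : 0 < x := hs.trans hx.1
      rw [(hasDerivAt_logSinhDefect hx0).deriv]
      exact div_nonneg (mul_cosh_sub_sinh_le_sq_mul_sinh hx0.le)
        (mul_nonneg hx0.le (Real.sinh_nonneg_iff.2 hx0.le))
    exact sub_nonneg.2 (this ⟨le_rfl, hsL⟩ ⟨hsL, le_rfl⟩ hsL)
  · refine (convex_Icc s L).image_sub_le_mul_sub_of_deriv_le hcont hdiff (fun x hx => ?_)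
      s ⟨le_rfl, hsL⟩ L ⟨hsL, le_rfl⟩ hsL
    rw [interior_Icc] at hx
    have hx0 : 0 < x := hs.trans hx.1
    have hsx : x ≤ Real.sinh x := Real.self_le_sinh_iff.2 hx0.le
    rw [(hasDerivAt_logSinhDefect hx0).deriv,
      div_le_iff₀ (mul_pos hx0 (hx0.trans_le hsx))]
    have h1 := sq_mul_sinh_sub_le hC hx0.le hx.2.le
    have h2 : C * x ^ 5 / 45 ≤ C * L ^ 3 / 45 * (x * x) := by
      have : x ^ 3 ≤ L ^ 3 := by gcongr; exact hx.2.le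
      have := mul_le_mul_of_nonneg_left this (show 0 ≤ C * (x * x) / 45 by positivity)
      linarith
    have h3 : C * L ^ 3 / 45 * (x * x) ≤ C * L ^ 3 / 45 * (x * Real.sinh x) := by
      have : 0 ≤ L := by linarith [hx.2]
      gcongr
    linarith

lemma log_two_rpow_sub_one_div {x : ℝ} (hx : 0 < x) :
    Real.log ((2 ^ x - 1) / x) = Real.log (Real.log 2) + x * (Real.log 2 / 2)
      + (x * (Real.log 2 / 2)) ^ 2 / 6 - logSinhDefect (x * (Real.log 2 / 2)) := by
  have hl : 0 < Real.log 2 := Real.log_pos (by norm_num)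
  set t := x * (Real.log 2 / 2) with ht
  have ht0 : 0 < t := by positivity
  have hs : 0 < Real.sinh t := Real.sinh_pos_iff.2 ht0
  have e : (2 ^ x - 1) / x = Real.log 2 * Real.exp t * Real.sinh t / t := by
    have h2 : (2 : ℝ) ^ x = Real.exp t * Real.exp t := by
      rw [← Real.exp_add, Real.rpow_def_of_pos (by norm_num), ht]
      congr 1; ring
    have h3 : Real.exp t * Real.exp (-t) = 1 := by rw [← Real.exp_add]; simp
    rw [h2, Real.sinh_eq, div_eq_div_iff hx.ne' ht0.ne']
    linear_combination (Real.log 2 * x / 2) * h3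
      + (Real.exp t * Real.exp t - 1) * ht
  rw [e, Real.log_div (by positivity) ht0.ne', Real.log_mul (by positivity) hs.ne',
    Real.log_mul hl.ne' (Real.exp_pos t).ne', Real.log_exp, logSinhDefect]
  ring

/-- Writing `2 - 2 ^ α = 2 ^ α * (2 ^ β - 1)` makes the ratio symmetric in `α` and `β`. The
expansion at `x = 1`, where the logarithm vanishes, eliminates `log (log 2)`; then `α ^ 3 + β ^ 3 =
1 - 3 * α * β` leaves the quadratic main term. -/
lemma neg_log_huffmanRatio {α β : ℝ} (h0 : 0 < α) (hβ : 0 < β) (hαβ : α + β = 1) :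
    -Real.log (huffmanRatio α) = α * β * (Real.log 2 / 2) ^ 2 / 2
      - (α * (logSinhDefect (Real.log 2 / 2) - logSinhDefect (α * (Real.log 2 / 2)))
        + β * (logSinhDefect (Real.log 2 / 2) - logSinhDefect (β * (Real.log 2 / 2)))) := by
  obtain rfl : β = 1 - α := by linarith
  have h1 : α < 1 := by linarith
  have hu1 := one_lt_two_rpow h0
  have hu2 := one_lt_two_rpow hβ
  have e2 : 0 < (2 ^ α - 1) / α := div_pos (by linarith) h0
  have e3 : 0 < ((2 : ℝ) ^ (1 - α) - 1) / (1 - α) := div_pos (by linarith) hβ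
  have e1 : (2 - 2 ^ α) / (1 - α) = 2 ^ α * (((2 : ℝ) ^ (1 - α) - 1) / (1 - α)) := by
    have : (2 : ℝ) ^ α * 2 ^ (1 - α) = 2 := by
      rw [← Real.rpow_add (by norm_num)]; simp
    rw [← mul_div_assoc, mul_sub, this, mul_one]
  have e4 := log_two_rpow_sub_one_div one_pos
  simp only [Real.rpow_one, one_mul, div_one] at e4
  rw [show (2 : ℝ) - 1 = 1 by norm_num, Real.log_one] at e4
  rw [huffmanRatio, e1, Real.log_mul (by positivity) (by positivity),
    Real.log_rpow (by positivity), Real.log_rpow e2, Real.log_mul (by positivity) e3.ne',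
    Real.log_rpow (by norm_num), log_two_rpow_sub_one_div h0, log_two_rpow_sub_one_div hβ]
  linear_combination e4

theorem abs_mul_v_two_sub_le {ρ : ℝ} (hρ : 0 < ρ) :
    |ρ * v 2 (1 / (1 + ρ)) - 0.08607 * ρ / (1 + ρ)| ≤ 0.01 * (0.08607 * ρ / (1 + ρ)) := by
  obtain ⟨hα0, hα1⟩ := order_mem_Ioo hρ
  have h1ρ : 0 < 1 + ρ := by linarith
  set α := 1 / (1 + ρ) with hα
  have hβ : ρ / (1 + ρ) = 1 - α := by rw [hα]; field_simp; ring
  have hβ0 : 0 < 1 - α := by linarith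
  have hl := Real.log_two_gt_d9
  have hl' := Real.log_two_lt_d9
  have hl0 : 0 < Real.log 2 := by linarith
  -- On this interval `cosh x ≤ exp x ≤ √2 < 1.42`.
  have hC : ∀ x, 0 ≤ x → x ≤ Real.log 2 / 2 → Real.cosh x ≤ 1.42 := fun x hx hxL => by
    have h2 : Real.exp x ≤ 1.42 := by
      have hsq : Real.exp (Real.log 2 / 2) ^ 2 = 2 := by
        rw [← Real.exp_nat_mul]
        norm_num
        rw [mul_div_cancel₀ _ (by norm_num), Real.exp_log (by norm_num)]
      have := Real.exp_le_exp.2 hxL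
      nlinarith [Real.exp_pos (Real.log 2 / 2)]
    have h3 : Real.exp (-x) ≤ Real.exp x := Real.exp_le_exp.2 (by linarith)
    rw [Real.cosh_eq]
    linarith
  obtain ⟨lo1, up1⟩ := logSinhDefect_sub_bounds hC (s := α * (Real.log 2 / 2)) (by positivity)
    (mul_le_of_le_one_left (by positivity) hα1.le)
  obtain ⟨lo2, up2⟩ := logSinhDefect_sub_bounds hC (s := (1 - α) * (Real.log 2 / 2))
    (by positivity) (mul_le_of_le_one_left (by positivity) (by linarith))
  have hcube : 1.42 * (Real.log 2 / 2) ^ 3 / 45 ≤ 0.0014 := by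
    have : (Real.log 2 / 2) ^ 3 ≤ 0.347 ^ 3 := by gcongr; linarith
    norm_num at this ⊢
    linarith
  have hD := neg_log_huffmanRatio hα0 hβ0 (by ring)
  have hlogb := logb_huffmanRatio 2 hα0 hα1
  rw [Real.logb, div_eq_iff hl0.ne'] at hlogb
  -- Here `1 - α = ρ * α`, so multiplying by `α * log 2` turns `ρ * v` in bits into the natural
  -- logarithm.
  have hv : ρ * v 2 α * (α * Real.log 2) = -Real.log (huffmanRatio α) := by
    rw [hlogb, ← hβ, hα]; field_simp
  have hαβ : 0 < α * (1 - α) := mul_pos hα0 hβ0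
  have hup : ρ * v 2 α * (α * Real.log 2) ≤ α * (1 - α) * (Real.log 2 / 2) ^ 2 / 2 := by
    rw [hv, hD]
    linarith [mul_nonneg hα0.le lo1, mul_nonneg hβ0.le lo2]
  have hlo : α * (1 - α) * (Real.log 2 / 2) ^ 2 / 2 - α * (1 - α) * (0.0014 * Real.log 2)
      ≤ ρ * v 2 α * (α * Real.log 2) := by
    rw [hv, hD]
    have k1 := up1.trans (mul_le_mul_of_nonneg_right hcube
      (show 0 ≤ Real.log 2 / 2 - α * (Real.log 2 / 2) by nlinarith))
    have k2 := up2.trans (mul_le_mul_of_nonneg_right hcube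
      (show 0 ≤ Real.log 2 / 2 - (1 - α) * (Real.log 2 / 2) by nlinarith))
    have k1' := mul_le_mul_of_nonneg_left k1 hα0.le
    have k2' := mul_le_mul_of_nonneg_left k2 hβ0.le
    linarith
  have hαl : 0 < α * Real.log 2 := mul_pos hα0 hl0
  -- The outcome is `log 2 / 8 - 0.0014 ≤ ρ * v / (1 - α) ≤ log 2 / 8`, and both ends are within one
  -- percent of `0.08607`.
  have hup' : ρ * v 2 α ≤ (1 - α) * (Real.log 2 / 8) :=
    le_of_mul_le_mul_right (hup.trans_eq (by ring)) hαl
  have hlo' : (1 - α) * (Real.log 2 / 8 - 0.0014) ≤ ρ * v 2 α :=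
    le_of_mul_le_mul_right (le_trans (le_of_eq (by ring)) hlo) hαl
  rw [mul_div_assoc, hβ, abs_le]
  constructor
  · have := mul_le_mul_of_nonneg_left
      (show (0.99 * 0.08607 : ℝ) ≤ Real.log 2 / 8 - 0.0014 by norm_num; linarith) hβ0.le
    linarith
  · have := mul_le_mul_of_nonneg_left
      (show Real.log 2 / 8 ≤ (1.01 * 0.08607 : ℝ) by norm_num; linarith) hβ0.le
    linarith

end Numerics

end Guessing

theorem theorem3 (b : ℝ) (hb : 1 < b) (n m : ℕ) (hm : 2 ≤ m) (hmn : m < n)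
    (p : Fin n → ℝ) (hp : p ∈ stdSimplex ℝ (Fin n)) :
    -- (a) the lower bound, for every deterministic function
    (∀ f : Fin n → Fin m, ∀ ρ : ℝ, 0 < ρ → ∀ k : ℕ, 1 ≤ k →
      ∀ (Ω : Type*) [MeasurableSpace Ω] (μ : Measure Ω) [IsProbabilityMeasure μ]
        (X : Fin k → Ω → Fin n), Guessing.IsIIDSample μ p X →
      ∀ (g : (Fin k → Fin n) → ℕ) (h : (Fin k → Fin m) → ℕ),
        Guessing.IsRankingFunction μ (fun ω i => X i ω) g →
        Guessing.IsRankingFunction μ (fun ω i => f (X i ω)) h →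
        Guessing.lowerBound b p m ρ k ≤ Guessing.guessingReduction μ b ρ X f g h) ∧
    -- (b) the Huffman procedure yields a function, and each such function attains the upper bound
    (∃ f : Fin n → Fin m, Guessing.IsHuffmanMap p f) ∧
    (∀ f : Fin n → Fin m, Guessing.IsHuffmanMap p f → ∀ ρ : ℝ, 0 < ρ → ∀ k : ℕ, 1 ≤ k →
      ∀ (Ω : Type*) [MeasurableSpace Ω] (μ : Measure Ω) [IsProbabilityMeasure μ]
        (X : Fin k → Ω → Fin n), Guessing.IsIIDSample μ p X →
      ∀ (g : (Fin k → Fin n) → ℕ) (h : (Fin k → Fin m) → ℕ),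
        Guessing.IsRankingFunction μ (fun ω i => X i ω) g →
        Guessing.IsRankingFunction μ (fun ω i => f (X i ω)) h →
        Guessing.guessingReduction μ b ρ X f g h ≤ Guessing.upperBound b p m ρ k) ∧
    -- (c) the gap between the bounds for large `k`, and its value in bits within one percent
    (∀ ρ : ℝ, 0 < ρ →
      Tendsto (fun k : ℕ => Guessing.upperBound b p m ρ k - Guessing.lowerBound b p m ρ k)
        atTop (𝓝 (ρ * Guessing.v b (1 / (1 + ρ)))) ∧
      |ρ * Guessing.v 2 (1 / (1 + ρ)) - 0.08607 * ρ / (1 + ρ)|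
        ≤ 0.01 * (0.08607 * ρ / (1 + ρ))) := by
  refine ⟨fun f ρ hρ k hk Ω _ μ _ X hX g h hg hh => ?_, ?_,
    fun f hf ρ hρ k hk Ω _ μ _ X hX g h hg hh => ?_, fun ρ hρ => ⟨?_, ?_⟩⟩
  · exact Guessing.lowerBound_le_guessingReduction hb hm hmn hp.1 hp.2 hρ hk hX hg hh
  · exact Guessing.exists_isHuffmanMap p (by omega) hmn.le
  · exact Guessing.guessingReduction_le_upperBound hb hm hmn hp.1 hp.2 hf hρ hk hX hg hh
  · exact Guessing.tendsto_upperBound_sub_lowerBound b p m ρ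
  · exact Guessing.abs_mul_v_two_sub_le hρ
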